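/- **Setting.** Let $\mathcal A_P\subset\mathbb R^m$ be nonempty, convex and compact (the principal's strategies; the agent's forecasts also lie in $\mathcal A_P$), $\mathcal A_A\subset\mathbb R^k$ convex (the agent's actions), and $U_P,U_A$ real-valued utilities on $\mathcal A_P\times\mathcal A_A$. Assume: for every $p\in\mathcal A_P$ the best response $\mathrm{BR}(p)=\arg\max_{y\in\mathcal A_A}U_A(p,y)$ exists and is unique, and $\mathrm{BR}$ is $L_{\mathrm{BR}}$-Lipschitz on $\mathcal A_P$; $U_P$ is $L_1$-Lipschitz and concave in its first argument and $L_2$-Lipschitz in its second argument; and $h\mapsto U_P(h,\mathrm{BR}(h))$ is concave on $\mathcal A_P$. All Lipschitz constants are for the Euclidean norm. Let $V^\star=\max_{h\in\mathcal A_P}U_P(h,\mathrm{BR}(h))$. **Repeated game.** In round $t$ the principal chooses $h_t\in\mathcal A_P$ and, simultaneously, the agent forms a forecast $p_t\in\mathcal A_P$ from the past $(h_\tau,p_\tau)_{\tau<t}$ and private randomness; the agent then plays $y_t=\mathrm{BR}(p_t)$, and the principal receives $U_P(h_t,y_t)$. The principal's and the agent's private randomness are independent. **Calibration.** A binning is a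 finite family $\Pi=(w_i)_{i\le n}$ of functions $w_i:\mathcal A_P\to[0,1]$ with $\sum_iw_i\equiv1$. For rounds $s<t$ put $n_{[s,t]}(i)=\sum_{\tau=s}^tw_i(p_\tau)$, let $\bar p_{[s,t]}(i),\bar h_{[s,t]}(i)$ be the averages of $p_\tau,h_\tau$ over $\tau\in[s,t]$ with weights $w_i(p_\tau)/n_{[s,t]}(i)$, and let $$\mathrm{CalErr}_i(h_{s:t},p_{s:t})=\frac{n_{[s,t]}(i)}{t-s}\,\bigl\|\bar p_{[s,t]}(i)-\bar h_{[s,t]}(i)\bigr\|_\infty$$ (equal to $0$ when $n_{[s,t]}(i)=0$). The agent is $(0,\Pi)$-adaptively calibrated over $T$ rounds with rate $r_{\delta,T}(\cdot)$ if, against every (adaptive) sequence $h_1,\dots,h_T$ and for every $\delta\in(0,1)$, with probability at least $1-\delta$ one has $\mathrm{CalErr}_i(h_{s:t},p_{s:t})\le r_{\delta,T}(t-s)$ for all $1\le s<t\le T$ and all $i$. Agents that are calibrated over every horizon are considered; the agent and the rate may depend on the horizon $T$. For a finite $\varepsilon$-grid $\{x_1,\dots,x_n\}$ of $\mathcal A_P$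 (every point of $\mathcal A_P$ is within Euclidean distance $\varepsilon>0$ of some $x_i\in\mathcal A_P$), the tent binning is $w_i(p)=\Lambda(p;x_i,2\varepsilon)/\sum_j\Lambda(p;x_j,2\varepsilon)$ with $\Lambda(p;x,R)=(R-\|p-x\|_2)_+$. **LazyGDwoG** with query radius $\delta>0$, step sizes $\gamma_\phi>0$, $\Phi$ epochs of length $M$, and initial center $x_1\in B_2(\mathcal A_P,-\delta)$, where $B_2(\mathcal A_P,-\delta)$ is the set of centers of closed $\delta$-balls contained in $\mathcal A_P$ (assumed nonempty): in epoch $\phi$ draw $S_\phi$ uniformly from the unit sphere of $\mathbb R^m$, independently of everything else, play $h_\phi=x_\phi+\delta S_\phi$ in all $M$ rounds of the epoch, observe the actions $y_{\phi,1},\dots,y_{\phi,M}$, put $\bar y_\phi=\frac1M\sum_sy_{\phi,s}$, and let $x_{\phi+1}$ be the Euclidean projection of $x_\phi+\gamma_\phi\frac m\delta U_P(h_\phi,\bar y_\phi)S_\phi$ onto $B_2(\mathcal A_P,-\delta)$. **Theorem.** For every such $\mathcal A_P$, all constants $L_1,L_2,L_{\mathrm{BR}}\ge 0$ and every $\varepsilon_0>0$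 there is a finite tent binning $\Pi_0$ of $\mathcal A_P$ with the following two properties. 1. (Lower bound.) If $m\ge1$ and $\mathcal A_P$ has nonempty interior, then there is a choice of the parameters of LazyGDwoG (the radius and the step sizes may depend on the number of epochs $\Phi$, but not on $\mathcal A_A,U_P,U_A$, the agent or its rate) such that for every game on $\mathcal A_P$ satisfying the assumptions with constants $L_1,L_2,L_{\mathrm{BR}}$, every $(0,\Pi_0)$-adaptively calibrated agent with rate $r$, and arbitrary initial centers: as $\Phi\to\infty$ and $M\to\infty$ along any sequence of pairs $(\Phi,M)$ with $r_{\delta,\Phi M}(M-1)\to0$ for every $\delta\in(0,1)$, $$\Pr\Bigl[\frac1{\Phi M}\sum_{\phi\in[\Phi]}\sum_{i\in[M]}U_P(h_\phi,y_{\phi,i})\ \ge\ V^\star-\varepsilon_0\Bigr]\longrightarrow1 .$$ In particular, if the rate is an $o(1)$ function of the interval length that does not depend on $T$, this holds whenever $\Phi,M\to\infty$. 2. (Upper bound.) For every game on $\mathcal A_P$ satisfying the assumptions with constants $L_1,L_2,L_{\mathrm{BR}}$, every $(0,\Pi_0)$-adaptively calibrated agent whose rate satisfies $r_{\delta,T}(T-1)\to0$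 as $T\to\infty$ for every $\delta\in(0,1)$, and every (randomized, adaptive, possibly horizon-dependent) strategy of the principal, $$\Pr\Bigl[\frac1T\sum_{t\in[T]}U_P(h_t,y_t)\ \le\ V^\star+\varepsilon_0\Bigr]\longrightarrow1\qquad(T\to\infty).$$ -/

import Mathlib

open Set Filter Topology MeasureTheory ProbabilityTheory
open scoped NNReal ENNReal

noncomputable section

namespace CSG

/-- `ℝᵐ` with the Euclidean norm. -/
abbrev Euc (m : ℕ) := EuclideanSpace ℝ (Fin m)

/-! ### Binnings -/

/-- A binning of a forecast space `C`: finitely many weight functions `wᵢ : C → [0,1]`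
that sum to one at every forecast. -/
structure Binning (C : Type*) (n : ℕ) where
  w : Fin n → C → ℝ
  nonneg : ∀ i p, 0 ≤ w i p
  le_one : ∀ i p, w i p ≤ 1
  sum_eq_one : ∀ p, ∑ i, w i p = 1

/-- The tent function `Λ(p; x, R) = (R - ‖p - x‖₂)₊`. -/
def tent {m : ℕ} (p x : Euc m) (R : ℝ) : ℝ := max (R - ‖p - x‖) 0

/-- A finite `mesh`-grid of `A` with `n` points: every point of `A` is within Euclidean distance
`mesh` of a grid point. -/
structure Grid {m : ℕ} (A : Set (Euc m)) (n : ℕ) where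
  mesh : ℝ
  mesh_pos : 0 < mesh
  pt : Fin n → A
  covers : ∀ p ∈ A, ∃ i, ‖p - pt i‖ ≤ mesh

/-- The normalizing constant of the tent binning. -/
def Grid.total {m n : ℕ} {A : Set (Euc m)} (g : Grid A n) (p : A) : ℝ :=
  ∑ j, tent (p : Euc m) (g.pt j) (2 * g.mesh)

theorem tent_nonneg {m : ℕ} (p x : Euc m) (R : ℝ) : 0 ≤ tent p x R := le_max_right _ _

theorem Grid.total_pos {m n : ℕ} {A : Set (Euc m)} (g : Grid A n) (p : A) : 0 < g.total p := by
  obtain ⟨i, hi⟩ := g.covers p p.2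
  have h1 : 0 < tent (p : Euc m) (g.pt i) (2 * g.mesh) := by
    have := g.mesh_pos
    exact lt_max_of_lt_left (by linarith)
  exact lt_of_lt_of_le h1 (Finset.single_le_sum
    (f := fun j => tent (p : Euc m) (g.pt j) (2 * g.mesh))
    (fun j _ => tent_nonneg _ _ _) (Finset.mem_univ i))

/-- The tent binning of a grid of mesh `ε`:
`wᵢ(p) = Λ(p; xᵢ, 2ε) / ∑ⱼ Λ(p; xⱼ, 2ε)`. -/
def Grid.tentBinning {m n : ℕ} {A : Set (Euc m)} (g : Grid A n) : Binning A n where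
  w i p := tent (p : Euc m) (g.pt i) (2 * g.mesh) / g.total p
  nonneg i p := div_nonneg (tent_nonneg _ _ _) (g.total_pos p).le
  le_one i p := by
    rw [div_le_one (g.total_pos p)]
    exact Finset.single_le_sum (f := fun j => tent (p : Euc m) (g.pt j) (2 * g.mesh))
      (fun j _ => tent_nonneg _ _ _) (Finset.mem_univ i)
  sum_eq_one p := by
    rw [← Finset.sum_div]
    exact div_self (g.total_pos p).ne'

/-! ### Calibration error on an interval of rounds -/

section CalErr

variable {m n : ℕ} {A : Set (Euc m)}

/-- Effective number of activations of bin `i` by the forecasts `p` in the rounds `s, …, t`. -/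
def activations (W : Binning A n) (p : ℕ → A) (s t : ℕ) (i : Fin n) : ℝ :=
  ∑ τ ∈ Finset.Icc s t, W.w i (p τ)

/-- Average of the points `v τ` over the rounds `s, …, t`, weighted by the activation of bin `i`. -/
def binAverage (W : Binning A n) (p v : ℕ → A) (s t : ℕ) (i : Fin n) : Euc m :=
  ∑ τ ∈ Finset.Icc s t, (W.w i (p τ) / activations W p s t i) • (v τ : Euc m)

/-- `CalErrᵢ(h_{s:t}, p_{s:t}) = n_{[s,t]}(i) / (t - s) * ‖p̄_{[s,t]}(i) - h̄_{[s,t]}(i)‖_∞`.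
The norm is the sup norm, since it is taken in `Fin m → ℝ`. -/
def calErr (W : Binning A n) (h p : ℕ → A) (s t : ℕ) (i : Fin n) : ℝ :=
  activations W p s t i / ((t : ℝ) - (s : ℝ)) *
    ‖WithLp.ofLp (binAverage W p p s t i - binAverage W p h s t i)‖

end CalErr

/-! ### Repeated interaction

Rounds are numbered `0, 1, 2, …`. In round `t` an outcome `h_t` and a forecast `p_t` are chosen
simultaneously, each as a function of the past pairs `(h_τ, p_τ)`, `τ < t`. -/

/-- A deterministic adaptive rule choosing a point of `A` in each round from the past
(outcome, forecast) pairs. -/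
abbrev Rule (A : Type*) := (t : ℕ) → (Fin t → A × A) → A

/-- The first `t` (outcome, forecast) pairs when outcomes follow `adv` and forecasts follow `fc`. -/
def history {A : Type*} (adv fc : Rule A) : (t : ℕ) → Fin t → A × A
  | 0 => Fin.elim0
  | t + 1 => Fin.snoc (α := fun _ => A × A) (history adv fc t)
      (adv t (history adv fc t), fc t (history adv fc t))

/-- The outcome of round `t`. -/
def outcome {A : Type*} (adv fc : Rule A) (t : ℕ) : A := adv t (history adv fc t)

/-- The forecast of round `t`. -/
def forecast {A : Type*} (adv fc : Rule A) (t : ℕ) : A := fc t (history adv fc t)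

/-- A randomized adaptive policy: a rule that may also use a private random seed `ω : Ω`, jointly
measurable in the seed and the past. -/
structure Policy (A : Type*) [MeasurableSpace A] (Ω : Type*) [MeasurableSpace Ω] where
  rule : Ω → Rule A
  measurable_rule : ∀ t, Measurable fun z : Ω × (Fin t → A × A) => rule z.1 t z.2

/-- The forecasting procedure `σ` (a policy whose seed has law `μ`) is `(ε, W)`-adaptively
calibrated over `T` rounds with rate `r`: against every adaptive adversary, for every
`δ ∈ (0,1)`, with probability at least `1 - δ` the calibration error of every bin on every
interval of rounds `s < t` within the `T` rounds is at most `r δ (t - s) + ε`. -/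
def AdaptivelyCalibrated {m n : ℕ} {A : Set (Euc m)} {Ω : Type*} [MeasurableSpace Ω]
    (μ : Measure Ω) (σ : Policy A Ω) (T : ℕ) (ε : ℝ) (W : Binning A n) (r : ℝ → ℕ → ℝ) : Prop :=
  ∀ adv : Rule A, (∀ t, Measurable (adv t)) → ∀ δ ∈ Ioo (0 : ℝ) 1,
    1 - ENNReal.ofReal δ ≤
      μ {ω | ∀ s t, s < t → t < T → ∀ i,
        calErr W (outcome adv (σ.rule ω)) (forecast adv (σ.rule ω)) s t i ≤ r δ (t - s) + ε}

/-! ### Continuous Stackelberg games -/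

section Game

variable {m k : ℕ}

/-- The set of best responses of the agent, with actions in `B` and utility `UA`, to `p`. -/
def bestResponses (B : Set (Euc k)) (UA : Euc m → Euc k → ℝ) (p : Euc m) : Set (Euc k) :=
  {y | y ∈ B ∧ ∀ y' ∈ B, UA p y' ≤ UA p y}

/-- The best response to `p` (an element of `bestResponses B UA p` whenever there is one). -/
def BR (B : Set (Euc k)) (UA : Euc m → Euc k → ℝ) (p : Euc m) : Euc k :=
  Classical.epsilon fun y => y ∈ bestResponses B UA p

/-- The Stackelberg value `V* = max_{h ∈ A} max_{y ∈ BR(h)} U_P(h, y)`. -/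
def stackelbergValue (A : Set (Euc m)) (B : Set (Euc k)) (UP UA : Euc m → Euc k → ℝ) : ℝ :=
  sSup {u | ∃ h ∈ A, ∃ y ∈ bestResponses B UA h, u = UP h y}

/-- The assumptions on a continuous game with principal strategy space `A`, agent action
space `B`, and utilities `UP`, `UA`. (The assumptions on `A` itself stand separately.) -/
structure GameAssumptions (A : Set (Euc m)) (B : Set (Euc k)) (UP UA : Euc m → Euc k → ℝ)
    (L₁ L₂ LBR : ℝ≥0) : Prop where
  convex_actions : Convex ℝ B
  /-- `U_P` is `L₁`-Lipschitz in its first argument. -/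
  lipschitz_fst : ∀ y ∈ B, LipschitzOnWith L₁ (fun h => UP h y) A
  /-- `U_P` is `L₂`-Lipschitz in its second argument. -/
  lipschitz_snd : ∀ h ∈ A, LipschitzOnWith L₂ (UP h) B
  /-- `U_P` is concave in its first argument. -/
  concave_fst : ∀ y ∈ B, ConcaveOn ℝ A (fun h => UP h y)
  /-- The best response to every strategy exists and is unique. -/
  existsUnique_bestResponse : ∀ p ∈ A, ∃! y, y ∈ bestResponses B UA p
  /-- The best-response map is `LBR`-Lipschitz. -/
  lipschitz_BR : LipschitzOnWith LBR (BR B UA) A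
  /-- The principal's utility against a best-responding agent is concave. -/
  concave_BR : ConcaveOn ℝ A (fun h => UP h (BR B UA h))

end Game

/-! ### Lazy gradient descent without a gradient -/

section LazyGD

variable {m k : ℕ}

/-- `B₂(A, -δ)`: the points whose closed `δ`-ball is contained in `A`. -/
def shrink (A : Set (Euc m)) (δ : ℝ) : Set (Euc m) := {x | Metric.closedBall x δ ⊆ A}

/-- Nearest-point projection onto a nonempty set `K` (single-valued when `K` is closed and
convex). -/
def nearest (K : Set (Euc m)) [Nonempty K] (z : Euc m) : K :=
  Classical.epsilon fun x : K => ∀ w : K, ‖z - x‖ ≤ ‖z - w‖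

/-- Parameters of an instance of the algorithm on `A`: a query radius `δ` for which `B₂(A, -δ)`
is nonempty, and step sizes `γ_φ`. -/
structure LazyGDParams (A : Set (Euc m)) where
  radius : ℝ
  radius_pos : 0 < radius
  shrink_nonempty : (shrink A radius).Nonempty
  step : ℕ → ℝ
  step_pos : ∀ φ, 0 < step φ

variable {A : Set (Euc m)}

/-- The strategy played around center `x` in direction `S`, namely `x + δ S`. -/
def query (θ : LazyGDParams A) (x : shrink A θ.radius) (S : Metric.sphere (0 : Euc m) 1) : A :=
  ⟨(x : Euc m) + θ.radius • (S : Euc m), x.2 (by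
    have hS : ‖(S : Euc m)‖ = 1 := by simp
    simp [Metric.mem_closedBall, dist_eq_norm, norm_smul, hS, abs_of_pos θ.radius_pos])⟩

/-- The center of epoch `φ` when epochs have `M` rounds, `S φ` is the direction drawn in epoch `φ`
and `y t` is the agent's action in round `t`. After epoch `φ`, with played strategy
`h_φ = x_φ + δ S_φ` and average feedback `ȳ_φ = (1/M) ∑_s y_{φ,s}`, the center moves by the
one-point gradient estimate:
`x_{φ+1} = Proj_{B₂(A,-δ)} (x_φ + γ_φ (m/δ) U_P(h_φ, ȳ_φ) S_φ)`. -/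
def lazyGDCenter (UP : Euc m → Euc k → ℝ) (θ : LazyGDParams A) (init : shrink A θ.radius) (M : ℕ)
    (S : ℕ → Metric.sphere (0 : Euc m) 1) (y : ℕ → Euc k) : ℕ → shrink A θ.radius
  | 0 => init
  | φ + 1 =>
    let x := lazyGDCenter UP θ init M S y φ
    let ybar : Euc k := (M : ℝ)⁻¹ • ∑ s ∈ Finset.range M, y (φ * M + s)
    haveI : Nonempty (shrink A θ.radius) := ⟨init⟩
    nearest (shrink A θ.radius)
      ((x : Euc m) +
        (θ.step φ * ((m : ℝ) / θ.radius * UP (query θ x (S φ)) ybar)) • (S φ : Euc m))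

/-- The algorithm as an adaptive rule of the principal: round `t` belongs to epoch `t / M`, and in
every round of an epoch the query of that epoch is played. The past enters only through the
agent's actions `y_τ = BR(p_τ)`, `τ < t`; the value `0` for later rounds is never used. -/
def lazyGD (UP UA : Euc m → Euc k → ℝ) (B : Set (Euc k)) (θ : LazyGDParams A)
    (init : shrink A θ.radius) (M : ℕ) (S : ℕ → Metric.sphere (0 : Euc m) 1) : Rule A :=
  fun t past =>
    let y : ℕ → Euc k := fun τ => if hτ : τ < t then BR B UA (past ⟨τ, hτ⟩).2 else 0
    query θ (lazyGDCenter UP θ init M S y (t / M)) (S (t / M))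

/-- The uniform distribution on the unit sphere. -/
def sphereUniform (m : ℕ) : Measure (Metric.sphere (0 : Euc m) 1) :=
  ((volume : Measure (Euc m)).toSphere univ)⁻¹ • (volume : Measure (Euc m)).toSphere

/-- The principal's average utility over the first `T` rounds, when the principal follows `adv`
and the agent best responds to the forecasts made by `fc`. -/
def avgUtility (UP UA : Euc m → Euc k → ℝ) (B : Set (Euc k)) (adv fc : Rule A) (T : ℕ) : ℝ :=
  (∑ t ∈ Finset.range T,
    UP ((outcome adv fc t : A) : Euc m) (BR B UA ((forecast adv fc t : A) : Euc m))) / (T : ℝ)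

end LazyGD

end CSG

end

/-! Both bounds rest on one property of a tent binning of mesh `ε`: the weights form a partition of
unity, and a forecast with positive weight in bin `i` lies within `2ε` of the grid point `xᵢ`.
Calibration puts the weighted mean of the outcomes in a bin near that of the forecasts, hence near
`xᵢ` up to `2ε`, after weighting by the activation of the bin.

Upper bound (`sum_utility_le_of_calibrated`). While bin `i` is active the agent plays almost `yᵢ =
BR(xᵢ)`. With the action frozen at `yᵢ`, Jensen's inequality in the principal's strategy bounds the
average payoff in the bin by the payoff of the mean outcome, which is close to `U_P(xᵢ, BR(xᵢ)) ≤
V*`. Summing over bins leaves the error `2ε(L₁ + L₂ L_BR)` plus a multiple of the rate.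

Lower bound. When the principal repeats one strategy throughout an epoch, the mean outcome of every
active bin is that strategy, so on average the forecasts are within about `4ε` of it
(`sum_norm_forecast_sub_le`). The epoch therefore reveals `f(h) = U_P(h, BR(h))` up to a small
error, and the algorithm is projected ascent with one-point gradient estimates on a concave
Lipschitz function. Four facts give its regret: (a) `increment_le_integral_onePoint`: the mean
one-point estimate along `u` dominates `f(x + u) - f(x)` up to `2Lδ`. No smoothing of `f` or
divergence theorem is used; a reflection pairs each direction with its mirror image, and concavity
is applied on the line through the pair. (b) `regret_projected_ascent`: the usual potential
argument. (c) `measure_le_abs_sum_increments`: the deviations of the estimates from their means are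
martingale increments, since directions are independent and a center depends only on earlier ones;
Chebyshev's inequality suffices. (d) `exists_mem_shrink_stackelbergValue_le`: some nearly optimal
comparator lies in the inner parallel set. `sum_utility_lazyGD_ge` combines (a) and (b)
deterministically, on the event that calibration and noise are under control.

The forecast error enters the gradient multiplied by `mD/δ`. Hence the radius `δ` is fixed first,
from `ε₀`, and the mesh afterwards. Independence of the two seeds enters through Fubini: calibration
is used with the principal's seed frozen, the martingale bound with the agent's seed frozen. -/

noncomputable section

namespace CSG

/-! ### The uniform distribution on the sphere -/

section Sphere

variable {m : ℕ}

/-- The action of a linear isometry on the unit sphere. -/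
def sphereMap (R : Euc m ≃ₗᵢ[ℝ] Euc m) (s : Metric.sphere (0 : Euc m) 1) :
    Metric.sphere (0 : Euc m) 1 :=
  ⟨R s, by simp⟩

theorem continuous_sphereMap (R : Euc m ≃ₗᵢ[ℝ] Euc m) : Continuous (sphereMap R) := by
  unfold sphereMap
  fun_prop

-- The spherical measure of a set is a multiple of the volume of the cone over it. An isometry
-- commutes with scaling, so it maps cones to cones, and it preserves volume.
open scoped Pointwise in
theorem measurePreserving_sphereMap_toSphere (R : Euc m ≃ₗᵢ[ℝ] Euc m) :
    MeasurePreserving (sphereMap R) (volume : Measure (Euc m)).toSphere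
      (volume : Measure (Euc m)).toSphere := by
  refine ⟨(continuous_sphereMap R).measurable, ?_⟩
  ext s hs
  rw [Measure.map_apply (continuous_sphereMap R).measurable hs, Measure.toSphere_apply' _ hs,
    Measure.toSphere_apply' _ ((continuous_sphereMap R).measurable hs)]
  congr 1
  have key : (Ioo (0 : ℝ) 1 • (Subtype.val '' (sphereMap R ⁻¹' s)) : Set (Euc m)) =
      R ⁻¹' (Ioo (0 : ℝ) 1 • (Subtype.val '' s)) := by
    ext x
    simp only [Set.mem_smul, mem_image, mem_preimage, exists_exists_and_eq_and]
    constructor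
    · rintro ⟨c, hc, y, hy, rfl⟩
      exact ⟨c, hc, _, hy, by simp [sphereMap]⟩
    · rintro ⟨c, hc, y, hy, h⟩
      refine ⟨c, hc, sphereMap R.symm y, ?_, ?_⟩
      · convert hy
        ext1
        simp [sphereMap]
      · apply R.injective
        simp [sphereMap, h]
  rw [key]
  exact (LinearIsometryEquiv.measurePreserving R).measure_preimage_emb
    R.toHomeomorph.measurableEmbedding _

theorem measurePreserving_sphereMap (R : Euc m ≃ₗᵢ[ℝ] Euc m) :
    MeasurePreserving (sphereMap R) (sphereUniform m) (sphereUniform m) :=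
  (measurePreserving_sphereMap_toSphere R).smul_measure _

theorem isProbabilityMeasure_sphereUniform (hm : 0 < m) :
    IsProbabilityMeasure (sphereUniform m) := by
  have : Nonempty (Fin m) := ⟨⟨0, hm⟩⟩
  constructor
  rw [sphereUniform, Measure.smul_apply, smul_eq_mul]
  refine ENNReal.inv_mul_cancel ?_ (measure_ne_top _ _)
  rw [Ne, Measure.measure_univ_eq_zero]
  exact Measure.toSphere_ne_zero _

theorem integrable_sphereUniform (hm : 0 < m) {f : Metric.sphere (0 : Euc m) 1 → ℝ}
    (hf : Continuous f) : Integrable f (sphereUniform m) := by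
  have := isProbabilityMeasure_sphereUniform hm
  exact hf.integrable_of_hasCompactSupport (HasCompactSupport.of_compactSpace f)

theorem integral_sphereMap (R : Euc m ≃ₗᵢ[ℝ] Euc m) {f : Metric.sphere (0 : Euc m) 1 → ℝ}
    (hf : Continuous f) :
    ∫ s, f (sphereMap R s) ∂sphereUniform m = ∫ s, f s ∂sphereUniform m := by
  have h := integral_map (μ := sphereUniform m) (continuous_sphereMap R).measurable.aemeasurable
    (f := f) hf.aestronglyMeasurable
  rw [(measurePreserving_sphereMap R).map_eq] at h
  exact h.symm

/-- The second moment of a coordinate of a uniformly distributed unit vector. -/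
theorem integral_inner_sq (hm : 0 < m) {e : Euc m} (he : ‖e‖ = 1) :
    ∫ s, (inner ℝ (s : Euc m) e) ^ 2 ∂sphereUniform m = 1 / (m : ℝ) := by
  have := isProbabilityMeasure_sphereUniform hm
  have hcont : ∀ v : Euc m,
      Continuous fun s : Metric.sphere (0 : Euc m) 1 => (inner ℝ (s : Euc m) v) ^ 2 :=
    fun v => by fun_prop
  have hinv : ∀ i : Fin m, ∫ s, (inner ℝ (s : Euc m) (EuclideanSpace.single i (1 : ℝ))) ^ 2
      ∂sphereUniform m = ∫ s, (inner ℝ (s : Euc m) e) ^ 2 ∂sphereUniform m := by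
    intro i
    let v : Euc m := EuclideanSpace.single i (1 : ℝ)
    have hv : ‖e‖ = ‖v‖ := by simp [v, he]
    -- The reflection exchanging `e` and the coordinate vector shows that all unit vectors have the
    -- same second moment; the coordinate ones add up to `1`.
    let R : Euc m ≃ₗᵢ[ℝ] Euc m := (Submodule.span ℝ {e - v})ᗮ.reflection
    have hR : R e = v := Submodule.reflection_sub hv
    rw [← integral_sphereMap R (hcont v)]
    refine integral_congr_ae (ae_of_all _ fun s => ?_)
    change (inner ℝ (R s) v) ^ 2 = _
    rw [← hR, LinearIsometryEquiv.inner_map_map]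
  have hsum : ∑ i : Fin m, ∫ s, (inner ℝ (s : Euc m) (EuclideanSpace.single i (1 : ℝ))) ^ 2
      ∂sphereUniform m = 1 := by
    rw [← integral_finsetSum _ fun i _ => integrable_sphereUniform hm (hcont _)]
    have : ∀ s : Metric.sphere (0 : Euc m) 1,
        ∑ i : Fin m, (inner ℝ (s : Euc m) (EuclideanSpace.single i (1 : ℝ))) ^ 2 = 1 := by
      intro s
      have hs : ‖(s : Euc m)‖ = 1 := by simp
      have := EuclideanSpace.norm_sq_eq (s : Euc m)
      rw [hs] at this
      simp only [EuclideanSpace.inner_single_right, one_mul]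
      simpa using this.symm
    simp [this]
  simp only [hinv, Finset.sum_const, Finset.card_univ, Fintype.card_fin, nsmul_eq_mul] at hsum
  have : (m : ℝ) ≠ 0 := by positivity
  field_simp
  linarith

/-- One-point gradient estimates of a concave Lipschitz function: the spherical average of
`(m / δ) f(x + δ S) ⟨S, u⟩` dominates the increment `f(x + u) - f(x)` up to `2 L δ`. -/
theorem increment_le_integral_onePoint (hm : 0 < m) {A : Set (Euc m)} {f : Euc m → ℝ} {L : ℝ≥0}
    (hf : ConcaveOn ℝ A f) (hL : LipschitzOnWith L f A) {δ : ℝ} (hδ : 0 < δ) {x u : Euc m}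
    (hx : Metric.closedBall x δ ⊆ A) (hxu : Metric.closedBall (x + u) δ ⊆ A) :
    f (x + u) - f x - 2 * L * δ ≤
      ∫ s : Metric.sphere (0 : Euc m) 1,
        (m : ℝ) / δ * (f (x + δ • (s : Euc m)) * inner ℝ (s : Euc m) u) ∂sphereUniform m := by
  have := isProbabilityMeasure_sphereUniform hm
  rcases eq_or_ne u 0 with rfl | hu
  · simp; positivity
  have hu' : 0 < ‖u‖ := norm_pos_iff.2 hu
  set e : Euc m := ‖u‖⁻¹ • u with he
  have hue : u = ‖u‖ • e := by rw [he, smul_smul, mul_inv_cancel₀ hu'.ne', one_smul]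
  have he1 : ‖e‖ = 1 := by rw [he, norm_smul, norm_inv, norm_norm, inv_mul_cancel₀ hu'.ne']
  set d : ℝ := f (x + u) - f x - 2 * L * δ with hd
  have hmem : ∀ {y : Euc m}, Metric.closedBall y δ ⊆ A →
      ∀ s : Metric.sphere (0 : Euc m) 1, y + δ • (s : Euc m) ∈ A := by
    intro y hy s
    apply hy
    have hs : ‖(s : Euc m)‖ = 1 := by simp
    simp [Metric.mem_closedBall, dist_eq_norm, norm_smul, hs, abs_of_pos hδ]
  have hfc : ContinuousOn f A := hL.continuousOn
  let φ : Metric.sphere (0 : Euc m) 1 → ℝ :=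
    fun s => f (x + δ • (s : Euc m)) * inner ℝ (s : Euc m) e
  have hfs : Continuous fun s : Metric.sphere (0 : Euc m) 1 => f (x + δ • (s : Euc m)) :=
    hfc.comp_continuous (by fun_prop) (hmem hx)
  have hφ : Continuous φ := hfs.mul (by fun_prop)
  -- Reflection in the hyperplane orthogonal to `u`: it changes the sign of the inner product with
  -- `e` and preserves the measure.
  let R : Euc m ≃ₗᵢ[ℝ] Euc m := (Submodule.span ℝ {e})ᗮ.reflection
  have hRe : R e = -e := Submodule.reflection_orthogonalComplement_singleton_eq_neg e
  have hR : ∀ v, R v = v - (2 * inner ℝ v e) • e := by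
    intro v
    change (Submodule.span ℝ {e})ᗮ.reflection v = _
    rw [Submodule.reflection_orthogonal_apply, Submodule.reflection_singleton_apply, he1,
      real_inner_comm]
    simp [two_smul, two_mul, add_smul]
  have hRinner : ∀ v, inner ℝ (R v) e = -inner ℝ v e := by
    intro v
    have : inner ℝ (R v) (R e) = inner ℝ v e := LinearIsometryEquiv.inner_map_map _ _ _
    rw [hRe, inner_neg_right] at this
    linarith
  -- the concavity inequality on the line through `s` and its mirror image
  have hpos : ∀ s : Metric.sphere (0 : Euc m) 1, 0 ≤ inner ℝ (s : Euc m) e →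
      2 * δ * inner ℝ (s : Euc m) e * d ≤
        ‖u‖ * (f (x + δ • (s : Euc m)) - f (x + δ • (sphereMap R s : Euc m))) := by
    intro s hc
    set c := inner ℝ (s : Euc m) e with hcdef
    have ha : x + u + δ • (s : Euc m) ∈ A := hmem hxu s
    have hb : x + δ • (sphereMap R s : Euc m) ∈ A := hmem hx _
    have hden : 0 < 2 * δ * c + ‖u‖ := by positivity
    -- The points `x + δ R s`, `x + δ s` and `x + u + δ s` lie in this order on a line of direction
    -- `e`, with gaps `2δc` and `‖u‖`; the weights express the middle one through the outer two.
    have hcomb := hf.2 hb ha (show 0 ≤ ‖u‖ / (2 * δ * c + ‖u‖) by positivity)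
      (show 0 ≤ 2 * δ * c / (2 * δ * c + ‖u‖) by positivity) (by field_simp; ring)
    have hpt : (‖u‖ / (2 * δ * c + ‖u‖)) • (x + δ • (sphereMap R s : Euc m)) +
        (2 * δ * c / (2 * δ * c + ‖u‖)) • (x + u + δ • (s : Euc m)) = x + δ • (s : Euc m) := by
      have h1 : (sphereMap R s : Euc m) = s - (2 * c) • e := hR s
      have hw : x + δ • (sphereMap R s : Euc m) =
          (x + δ • (s : Euc m)) - (2 * δ * c) • e := by rw [h1]; module
      have hw2 : x + u + δ • (s : Euc m) = (x + δ • (s : Euc m)) + ‖u‖ • e := by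
        rw [← hue]; module
      rw [hw, hw2]
      match_scalars
      · field_simp
        ring
      · field_simp
        ring
      · field_simp
        ring
    rw [hpt] at hcomb
    simp only [smul_eq_mul] at hcomb
    have hcomb' : ‖u‖ * f (x + δ • (sphereMap R s : Euc m)) +
        2 * δ * c * f (x + u + δ • (s : Euc m)) ≤
        (2 * δ * c + ‖u‖) * f (x + δ • (s : Euc m)) := by
      have := mul_le_mul_of_nonneg_left hcomb hden.le
      refine le_trans (le_of_eq ?_) this
      field_simp
    have hs : ‖(s : Euc m)‖ = 1 := by simp
    have hlip : ∀ {y : Euc m}, Metric.closedBall y δ ⊆ A →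
        |f (y + δ • (s : Euc m)) - f y| ≤ L * δ := by
      intro y hy
      have := hL.dist_le_mul _ (hmem hy s) y (hy (Metric.mem_closedBall_self hδ.le))
      simpa [Real.dist_eq, dist_eq_norm, norm_smul, hs, abs_of_pos hδ] using this
    have h1 := abs_le.1 (hlip hx)
    have h2 := abs_le.1 (hlip hxu)
    have h3 : d ≤ f (x + u + δ • (s : Euc m)) - f (x + δ • (s : Euc m)) := by
      rw [hd]; linarith [h1.2, h2.1]
    have h4 := mul_le_mul_of_nonneg_left h3 (show 0 ≤ 2 * δ * c by positivity)
    linarith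
  have hinvol : ∀ s : Metric.sphere (0 : Euc m) 1, sphereMap R (sphereMap R s) = s := by
    intro s
    ext1
    exact Submodule.reflection_reflection _ _
  have hpt : ∀ s : Metric.sphere (0 : Euc m) 1,
      2 * δ / ‖u‖ * d * (inner ℝ (s : Euc m) e) ^ 2 ≤ φ s + φ (sphereMap R s) := by
    intro s
    have hflip : inner ℝ (sphereMap R s : Euc m) e = -inner ℝ (s : Euc m) e := hRinner s
    have hgoal : φ s + φ (sphereMap R s) = inner ℝ (s : Euc m) e *
        (f (x + δ • (s : Euc m)) - f (x + δ • (sphereMap R s : Euc m))) := by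
      simp only [φ, hflip]; ring
    rw [hgoal]
    set c := inner ℝ (s : Euc m) e with hcdef
    rw [show 2 * δ / ‖u‖ * d * c ^ 2 = c * (2 * δ * c * d) / ‖u‖ by ring, div_le_iff₀ hu']
    rcases le_total 0 c with hc | hc
    · have := mul_le_mul_of_nonneg_left (hpos s hc) hc
      linarith
    -- For a negative inner product, the roles of the direction and its mirror image are exchanged.
    · have h := hpos (sphereMap R s) (by rw [hflip]; linarith)
      rw [hinvol, hflip] at h
      have := mul_le_mul_of_nonneg_left h (neg_nonneg.2 hc)
      linarith
  -- After averaging, the second moment `1/m` on the left cancels the factor `m` of the estimate.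
  have hint := integral_mono (μ := sphereUniform m)
    (integrable_sphereUniform hm (by fun_prop))
    ((integrable_sphereUniform hm hφ).add
      (integrable_sphereUniform hm (hφ.comp (continuous_sphereMap R)))) hpt
  rw [integral_const_mul, integral_inner_sq hm he1] at hint
  have hsum : ∫ s, (φ + φ ∘ sphereMap R) s ∂sphereUniform m = 2 * ∫ s, φ s ∂sphereUniform m := by
    rw [integral_add' (integrable_sphereUniform hm hφ)
      (integrable_sphereUniform hm (hφ.comp (continuous_sphereMap R)))]
    simp only [Function.comp_apply]
    rw [integral_sphereMap R hφ]
    ring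
  rw [hsum] at hint
  have hout : ∫ s : Metric.sphere (0 : Euc m) 1,
        (m : ℝ) / δ * (f (x + δ • (s : Euc m)) * inner ℝ (s : Euc m) u) ∂sphereUniform m =
      (m : ℝ) / δ * ‖u‖ * ∫ s, φ s ∂sphereUniform m := by
    rw [← integral_const_mul]
    refine integral_congr_ae (ae_of_all _ fun s => ?_)
    have : inner ℝ (s : Euc m) u = ‖u‖ * inner ℝ (s : Euc m) e := by
      conv_lhs => rw [hue, inner_smul_right]
    simp only [φ, this]
    ring
  rw [hout]
  have hm' : (0 : ℝ) < m := by exact_mod_cast hm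
  have := mul_le_mul_of_nonneg_left hint (show 0 ≤ (m : ℝ) / δ * ‖u‖ / 2 by positivity)
  refine le_trans (le_of_eq ?_) (this.trans (le_of_eq ?_))
  · field_simp
  · ring

end Sphere

/-! ### Projections and inner parallel sets -/

section Projection

variable {m : ℕ}

theorem nearest_spec {K : Set (Euc m)} [Nonempty K] (hc : IsClosed K) (hK : Convex ℝ K)
    (z w : Euc m) (hw : w ∈ K) : inner ℝ (z - nearest K z) (w - nearest K z) ≤ 0 := by
  have hne : K.Nonempty := Set.nonempty_coe_sort.1 inferInstance
  have hex : ∃ x : K, ∀ w : K, ‖z - x‖ ≤ ‖z - w‖ := by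
    obtain ⟨v, hv, h⟩ := exists_norm_eq_iInf_of_complete_convex hne hc.isComplete hK z
    refine ⟨⟨v, hv⟩, fun w => ?_⟩
    change ‖z - v‖ ≤ _
    rw [h]
    exact ciInf_le ⟨0, Set.forall_mem_range.2 fun _ => norm_nonneg _⟩ w
  have hmin : ∀ w : K, ‖z - nearest K z‖ ≤ ‖z - w‖ := Classical.epsilon_spec hex
  refine (norm_eq_iInf_iff_real_inner_le_zero hK (nearest K z).2).1 ?_ w hw
  exact le_antisymm (le_ciInf hmin) (ciInf_le ⟨0, Set.forall_mem_range.2 fun _ => norm_nonneg _⟩ _)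

/-- Add the variational inequalities of the two projections and apply Cauchy–Schwarz. Only the
resulting continuity is used, for measurability of the centers. -/
theorem norm_nearest_sub_le {K : Set (Euc m)} [Nonempty K] (hc : IsClosed K) (hK : Convex ℝ K)
    (z z' : Euc m) : ‖(nearest K z : Euc m) - nearest K z'‖ ≤ ‖z - z'‖ := by
  have h1 := nearest_spec hc hK z _ (nearest K z').2
  have h2 := nearest_spec hc hK z' _ (nearest K z).2
  set a : Euc m := (nearest K z).1
  set b : Euc m := (nearest K z').1
  have h3 : ‖a - b‖ ^ 2 ≤ inner ℝ (z - z') (a - b) := by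
    rw [← real_inner_self_eq_norm_sq]
    have e1 : inner ℝ (z - a) (b - a) + inner ℝ (z' - b) (a - b) =
        inner ℝ (a - b) (a - b) - inner ℝ (z - z') (a - b) := by
      simp only [inner_sub_left, inner_sub_right]
      ring
    linarith
  have h4 := real_inner_le_norm (z - z') (a - b)
  rcases (norm_nonneg (a - b)).eq_or_lt with h | h
  · rw [← h]; exact norm_nonneg _
  · nlinarith

/-- The angle at the projection is obtuse, so projecting never moves away from a comparator in the
set; this is what the regret bound needs. -/
theorem norm_nearest_sub_mem_le {K : Set (Euc m)} [Nonempty K] (hc : IsClosed K) (hK : Convex ℝ K)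
    (z : Euc m) {w : Euc m} (hw : w ∈ K) : ‖(nearest K z : Euc m) - w‖ ≤ ‖z - w‖ := by
  have h := nearest_spec hc hK z w hw
  set a : Euc m := (nearest K z).1
  have e : ‖z - w‖ ^ 2 = ‖z - a‖ ^ 2 - 2 * inner ℝ (z - a) (w - a) + ‖a - w‖ ^ 2 := by
    rw [show z - w = (z - a) - (w - a) by abel, norm_sub_sq_real, norm_sub_rev a w]
  refine le_of_sq_le_sq ?_ (norm_nonneg _)
  nlinarith [sq_nonneg ‖z - a‖]

theorem continuous_nearest {K : Set (Euc m)} [Nonempty K] (hc : IsClosed K) (hK : Convex ℝ K) :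
    Continuous (nearest K) := by
  refine (LipschitzWith.of_dist_le_mul (K := 1) fun z z' => ?_).continuous
  rw [Subtype.dist_eq, dist_eq_norm, dist_eq_norm]
  simpa using norm_nearest_sub_le hc hK z z'

theorem convex_shrink {A : Set (Euc m)} (hA : Convex ℝ A) (δ : ℝ) : Convex ℝ (shrink A δ) := by
  intro x hx y hy a b ha hb hab z hz
  have hxm : x + (z - (a • x + b • y)) ∈ A := hx (by simpa [dist_eq_norm] using hz)
  have hym : y + (z - (a • x + b • y)) ∈ A := hy (by simpa [dist_eq_norm] using hz)
  have := hA hxm hym ha hb hab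
  convert this using 1
  have hb' : b = 1 - a := by linarith
  subst hb'
  module

theorem isClosed_shrink {A : Set (Euc m)} (hA : IsClosed A) (δ : ℝ) : IsClosed (shrink A δ) := by
  have : shrink A δ = ⋂ v ∈ Metric.closedBall (0 : Euc m) δ, (fun x => x + v) ⁻¹' A := by
    ext x
    simp only [shrink, mem_ofPred_eq, mem_iInter, mem_preimage]
    constructor
    · intro h v hv
      exact h (by simpa [dist_eq_norm] using hv)
    · intro h z hz
      have := h (z - x) (by simpa [dist_eq_norm] using hz)
      simpa using this
  rw [this]
  exact isClosed_biInter fun v _ => hA.preimage (by fun_prop)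

theorem shrink_subset {A : Set (Euc m)} {δ : ℝ} (hδ : 0 ≤ δ) : shrink A δ ⊆ A :=
  fun _ hx => hx (Metric.mem_closedBall_self hδ)

/-- Moving a point of a convex set towards the center of an inscribed ball. -/
theorem convexCombination_mem_shrink {A : Set (Euc m)} (hA : Convex ℝ A) {c x : Euc m} {ρ t : ℝ}
    (hc : Metric.closedBall c ρ ⊆ A) (hx : x ∈ A) (ht : 0 < t) (ht1 : t ≤ 1) :
    (1 - t) • x + t • c ∈ shrink A (t * ρ) := by
  intro z hz
  -- The displacement of `z` is blown up by `1/t` and charged entirely to the ball around `c`.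
  have hmem : c + t⁻¹ • (z - ((1 - t) • x + t • c)) ∈ A := by
    apply hc
    rw [Metric.mem_closedBall, dist_eq_norm] at hz ⊢
    rw [add_sub_cancel_left, norm_smul, norm_inv, Real.norm_of_nonneg ht.le]
    rw [inv_mul_le_iff₀ ht]
    exact hz
  have := hA hx hmem (a := 1 - t) (b := t) (by linarith) ht.le (by ring)
  convert this using 1
  rw [smul_add, smul_smul, mul_inv_cancel₀ ht.ne']
  module

/-- The regret of projected online gradient ascent with a constant step size. -/
theorem regret_projected_ascent {x : ℕ → Euc m} {v : ℕ → Euc m} {w : Euc m} {γ G D : ℝ}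
    (hγ : 0 < γ) (hx : ∀ φ, ‖x (φ + 1) - w‖ ≤ ‖x φ + γ • v φ - w‖) (hv : ∀ φ, ‖v φ‖ ≤ G)
    (hD : ‖x 0 - w‖ ≤ D) (N : ℕ) :
    ∑ φ ∈ Finset.range N, inner ℝ (v φ) (w - x φ) ≤ D ^ 2 / (2 * γ) + γ / 2 * G ^ 2 * N := by
  -- The squared distance to the comparator is kept on the left as a potential, so that the
  -- induction telescopes.
  have key : ∀ N : ℕ, 2 * γ * ∑ φ ∈ Finset.range N, inner ℝ (v φ) (w - x φ) + ‖x N - w‖ ^ 2 ≤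
      ‖x 0 - w‖ ^ 2 + γ ^ 2 * G ^ 2 * N := by
    intro N
    induction N with
    | zero => simp
    | succ N ih =>
      rw [Finset.sum_range_succ]
      have h1 : ‖x (N + 1) - w‖ ^ 2 ≤ ‖x N + γ • v N - w‖ ^ 2 :=
        pow_le_pow_left₀ (norm_nonneg _) (hx N) 2
      have h2 : ‖x N + γ • v N - w‖ ^ 2 =
          ‖x N - w‖ ^ 2 - 2 * γ * inner ℝ (v N) (w - x N) + γ ^ 2 * ‖v N‖ ^ 2 := by
        rw [show x N + γ • v N - w = (x N - w) + γ • v N by abel, norm_add_sq_real,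
          inner_smul_right, norm_smul, real_inner_comm, ← neg_sub w (x N), inner_neg_right,
          Real.norm_of_nonneg hγ.le]
        ring
      have h3 : ‖v N‖ ^ 2 ≤ G ^ 2 := pow_le_pow_left₀ (norm_nonneg _) (hv N) 2
      have h4 : γ ^ 2 * ‖v N‖ ^ 2 ≤ γ ^ 2 * G ^ 2 := by gcongr
      push_cast
      linarith
  have h := key N
  have h0 : ‖x 0 - w‖ ^ 2 ≤ D ^ 2 := pow_le_pow_left₀ (norm_nonneg _) hD 2
  have h5 : 2 * γ * ∑ φ ∈ Finset.range N, inner ℝ (v φ) (w - x φ) ≤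
      D ^ 2 + γ ^ 2 * G ^ 2 * N := by nlinarith [sq_nonneg ‖x N - w‖]
  rw [← mul_le_mul_iff_right₀ (show 0 < 2 * γ by positivity)]
  refine h5.trans (le_of_eq ?_)
  field_simp

end Projection

/-! ### Tent binnings -/

section TentBinning

variable {m n : ℕ} {A : Set (Euc m)}

/-- A nonempty compact set has finite grids of arbitrarily small mesh. -/
theorem exists_grid (hA : IsCompact A) {ε : ℝ} (hε : 0 < ε) :
    ∃ (n : ℕ) (g : Grid A n), g.mesh = ε := by
  obtain ⟨c, hcA, hfin, hcov⟩ := hA.finite_cover_balls hε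
  have : Fintype c := hfin.fintype
  let E := (Fintype.equivFin c).symm
  refine ⟨Fintype.card c, ⟨ε, hε, fun i => ⟨E i, hcA (E i).2⟩, fun p hp => ?_⟩, rfl⟩
  obtain ⟨x, hx, hpx⟩ := mem_iUnion₂.1 (hcov hp)
  refine ⟨Fintype.equivFin c ⟨x, hx⟩, ?_⟩
  have : p ∈ Metric.ball x ε := hpx
  rw [Metric.mem_ball, dist_eq_norm] at this
  simpa [E] using this.le

theorem norm_sub_pt_le (g : Grid A n) {i : Fin n} {p : A} (h : g.tentBinning.w i p ≠ 0) :
    ‖(p : Euc m) - g.pt i‖ ≤ 2 * g.mesh := by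
  by_contra! hlt
  refine h ?_
  have : tent (p : Euc m) (g.pt i) (2 * g.mesh) = 0 := max_eq_right (by linarith)
  simp [Grid.tentBinning, this]

theorem euclidean_norm_le_sqrt_mul_sup_norm (v : Euc m) :
    ‖v‖ ≤ Real.sqrt m * ‖WithLp.ofLp v‖ := by
  rw [EuclideanSpace.norm_eq, ← Real.sqrt_sq (norm_nonneg (WithLp.ofLp v)),
    ← Real.sqrt_mul (by positivity)]
  refine Real.sqrt_le_sqrt ?_
  calc ∑ i, ‖v i‖ ^ 2 ≤ ∑ _i : Fin m, ‖WithLp.ofLp v‖ ^ 2 :=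
        Finset.sum_le_sum fun i _ => pow_le_pow_left₀ (norm_nonneg _) (norm_le_pi_norm v.ofLp i) 2
    _ = _ := by simp

variable (W : Binning A n) (p h : ℕ → A) (s t : ℕ)

theorem activations_nonneg (i : Fin n) : 0 ≤ activations W p s t i :=
  Finset.sum_nonneg fun _ _ => W.nonneg _ _

theorem sum_activations (hst : s ≤ t) : ∑ i, activations W p s t i = (t : ℝ) + 1 - s := by
  unfold activations
  rw [Finset.sum_comm]
  simp only [W.sum_eq_one, Finset.sum_const, Nat.card_Icc, nsmul_eq_mul, mul_one]
  rw [Nat.cast_sub (by omega)]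
  push_cast
  ring

variable {W p h s t}

theorem sum_div_activations {i : Fin n} (hi : 0 < activations W p s t i) :
    ∑ τ ∈ Finset.Icc s t, W.w i (p τ) / activations W p s t i = 1 := by
  rw [← Finset.sum_div]
  exact div_self hi.ne'

theorem weight_eq_zero_of_activations {i : Fin n} (hi : activations W p s t i = 0) {τ : ℕ}
    (hτ : τ ∈ Finset.Icc s t) : W.w i (p τ) = 0 :=
  (Finset.sum_eq_zero_iff_of_nonneg fun _ _ => W.nonneg _ _).1 hi τ hτ

theorem norm_binAverage_sub_pt_le (g : Grid A n) {i : Fin n}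
    (hi : 0 < activations g.tentBinning p s t i) :
    ‖binAverage g.tentBinning p p s t i - g.pt i‖ ≤ 2 * g.mesh := by
  set a := activations g.tentBinning p s t i with ha
  have h1 : binAverage g.tentBinning p p s t i - g.pt i =
      ∑ τ ∈ Finset.Icc s t, (g.tentBinning.w i (p τ) / a) • ((p τ : Euc m) - g.pt i) := by
    simp only [smul_sub, Finset.sum_sub_distrib, ← Finset.sum_smul]
    rw [sum_div_activations hi, one_smul]
    rfl
  rw [h1]
  calc _ ≤ ∑ τ ∈ Finset.Icc s t, ‖(g.tentBinning.w i (p τ) / a) • ((p τ : Euc m) - g.pt i)‖ :=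
        norm_sum_le _ _
    _ ≤ ∑ τ ∈ Finset.Icc s t, g.tentBinning.w i (p τ) / a * (2 * g.mesh) := by
        refine Finset.sum_le_sum fun τ _ => ?_
        have h0 : 0 ≤ g.tentBinning.w i (p τ) / a := div_nonneg (g.tentBinning.nonneg _ _) hi.le
        rw [norm_smul, Real.norm_of_nonneg h0]
        by_cases hw : g.tentBinning.w i (p τ) = 0
        · simp [hw]
        · exact mul_le_mul_of_nonneg_left (norm_sub_pt_le g hw) h0
    _ = 2 * g.mesh := by
        rw [← Finset.sum_mul, sum_div_activations hi, one_mul]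

/-- Keeping the activation as a factor avoids dividing by it when a bin is hardly used. The `√m`
converts the sup norm of the calibration error to the Euclidean norm. -/
theorem activations_mul_norm_le {i : Fin n} (hst : s < t) {q : ℝ}
    (hq : calErr W h p s t i ≤ q) :
    activations W p s t i * ‖binAverage W p p s t i - binAverage W p h s t i‖ ≤
      Real.sqrt m * (((t : ℝ) - s) * q) := by
  have hts : (0 : ℝ) < (t : ℝ) - s := by
    have : (s : ℝ) < t := by exact_mod_cast hst
    linarith
  have h1 : activations W p s t i *
      ‖WithLp.ofLp (binAverage W p p s t i - binAverage W p h s t i)‖ ≤ ((t : ℝ) - s) * q := by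
    unfold calErr at hq
    rw [div_mul_eq_mul_div, div_le_iff₀ hts] at hq
    linarith
  calc _ ≤ activations W p s t i *
        (Real.sqrt m * ‖WithLp.ofLp (binAverage W p p s t i - binAverage W p h s t i)‖) :=
        mul_le_mul_of_nonneg_left (euclidean_norm_le_sqrt_mul_sup_norm _)
          (activations_nonneg W p s t i)
    _ = Real.sqrt m * (activations W p s t i *
        ‖WithLp.ofLp (binAverage W p p s t i - binAverage W p h s t i)‖) := by ring
    _ ≤ _ := mul_le_mul_of_nonneg_left h1 (Real.sqrt_nonneg _)

/-- Calibrated forecasts of a constant outcome are close to that outcome on average. -/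
theorem sum_norm_forecast_sub_le (g : Grid A n) (hst : s < t) {q : ℝ} (hq0 : 0 ≤ q)
    (hq : ∀ i, calErr g.tentBinning h p s t i ≤ q) {x : A}
    (hx : ∀ τ ∈ Finset.Icc s t, h τ = x) :
    ∑ τ ∈ Finset.Icc s t, ‖(p τ : Euc m) - x‖ ≤
      ((t : ℝ) + 1 - s) * (4 * g.mesh + Real.sqrt m * n * q) := by
  have hbin : ∀ i, ∑ τ ∈ Finset.Icc s t, g.tentBinning.w i (p τ) * ‖(p τ : Euc m) - x‖ ≤
      activations g.tentBinning p s t i * (4 * g.mesh) + Real.sqrt m * (((t : ℝ) - s) * q) := by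
    intro i
    have hcal := activations_mul_norm_le hst (hq i)
    rcases (activations_nonneg g.tentBinning p s t i).eq_or_lt with h0 | h0
    · rw [Finset.sum_eq_zero fun τ hτ => by
        rw [weight_eq_zero_of_activations h0.symm hτ, zero_mul]]
      rw [← h0] at hcal ⊢
      linarith
    -- The outcome is constant, so every weighted mean of it is `x`, whatever the forecasts are.
    · have hh : binAverage g.tentBinning p h s t i = x := by
        unfold binAverage
        rw [Finset.sum_congr rfl fun τ hτ => by rw [hx τ hτ], ← Finset.sum_smul,
          sum_div_activations h0, one_smul]
      rw [hh] at hcal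
      have hb := norm_binAverage_sub_pt_le g h0
      set b := binAverage g.tentBinning p p s t i
      calc _ ≤ ∑ τ ∈ Finset.Icc s t, g.tentBinning.w i (p τ) * (4 * g.mesh + ‖b - x‖) := by
            refine Finset.sum_le_sum fun τ _ => ?_
            by_cases hw : g.tentBinning.w i (p τ) = 0
            · simp [hw]
            · refine mul_le_mul_of_nonneg_left ?_ (g.tentBinning.nonneg _ _)
              have h1 := norm_sub_pt_le g hw
              -- Through the grid point and the mean forecast of the bin: each of the first two
              -- distances is at most `2ε`.
              have h2 : ‖(p τ : Euc m) - x‖ ≤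
                  ‖(p τ : Euc m) - g.pt i‖ + ‖b - g.pt i‖ + ‖b - x‖ := by
                have e : (p τ : Euc m) - x =
                  ((p τ : Euc m) - g.pt i) - (b - g.pt i) + (b - x) := by abel
                rw [e]
                exact (norm_add_le _ _).trans (by gcongr; exact norm_sub_le _ _)
              linarith
        _ = activations g.tentBinning p s t i * (4 * g.mesh + ‖b - x‖) := by
            rw [← Finset.sum_mul]; rfl
        _ ≤ _ := by rw [mul_add]; linarith
  calc ∑ τ ∈ Finset.Icc s t, ‖(p τ : Euc m) - x‖
      = ∑ i, ∑ τ ∈ Finset.Icc s t, g.tentBinning.w i (p τ) * ‖(p τ : Euc m) - x‖ := by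
        rw [Finset.sum_comm]
        refine Finset.sum_congr rfl fun τ _ => ?_
        rw [← Finset.sum_mul, g.tentBinning.sum_eq_one, one_mul]
    _ ≤ ∑ i, (activations g.tentBinning p s t i * (4 * g.mesh) +
          Real.sqrt m * (((t : ℝ) - s) * q)) := Finset.sum_le_sum fun i _ => hbin i
    _ = ((t : ℝ) + 1 - s) * (4 * g.mesh) + n * (Real.sqrt m * (((t : ℝ) - s) * q)) := by
        rw [Finset.sum_add_distrib, ← Finset.sum_mul, sum_activations _ _ _ _ hst.le]
        simp
    -- The calibration error is normalized by `t - s` but the interval has `t - s + 1` rounds; the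
    -- larger number is used for both.
    _ ≤ _ := by
        have : 0 ≤ n * (Real.sqrt m * q) := by positivity
        nlinarith

end TentBinning

/-! ### Consequences of the assumptions on the game -/

section Game

variable {m k n : ℕ} {A : Set (Euc m)} {B : Set (Euc k)} {UP UA : Euc m → Euc k → ℝ}
  {L₁ L₂ LBR : ℝ≥0}

theorem BR_mem_bestResponses (H : GameAssumptions A B UP UA L₁ L₂ LBR) {p : Euc m} (hp : p ∈ A) :
    BR B UA p ∈ bestResponses B UA p :=
  Classical.epsilon_spec (H.existsUnique_bestResponse p hp).exists

theorem BR_mem (H : GameAssumptions A B UP UA L₁ L₂ LBR) {p : Euc m} (hp : p ∈ A) :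
    BR B UA p ∈ B := (BR_mem_bestResponses H hp).1

theorem norm_BR_sub_le (H : GameAssumptions A B UP UA L₁ L₂ LBR) {p q : Euc m} (hp : p ∈ A)
    (hq : q ∈ A) : ‖BR B UA p - BR B UA q‖ ≤ LBR * ‖p - q‖ := by
  simpa [dist_eq_norm] using H.lipschitz_BR.dist_le_mul p hp q hq

theorem abs_UP_sub_le_fst (H : GameAssumptions A B UP UA L₁ L₂ LBR) {p q : Euc m} (hp : p ∈ A)
    (hq : q ∈ A) {y : Euc k} (hy : y ∈ B) : |UP p y - UP q y| ≤ L₁ * ‖p - q‖ := by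
  simpa [dist_eq_norm, Real.dist_eq] using (H.lipschitz_fst y hy).dist_le_mul p hp q hq

theorem abs_UP_sub_le_snd (H : GameAssumptions A B UP UA L₁ L₂ LBR) {p : Euc m} (hp : p ∈ A)
    {y z : Euc k} (hy : y ∈ B) (hz : z ∈ B) : |UP p y - UP p z| ≤ L₂ * ‖y - z‖ := by
  simpa [dist_eq_norm, Real.dist_eq] using (H.lipschitz_snd p hp).dist_le_mul y hy z hz

/-- The principal's utility against a best-responding agent is Lipschitz. -/
theorem lipschitzOn_UP_BR (H : GameAssumptions A B UP UA L₁ L₂ LBR) :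
    LipschitzOnWith (L₁ + L₂ * LBR) (fun h => UP h (BR B UA h)) A := by
  refine LipschitzOnWith.of_dist_le_mul fun p hp q hq => ?_
  rw [Real.dist_eq, dist_eq_norm]
  have h1 := abs_UP_sub_le_fst H hp hq (BR_mem H hp)
  have h2 := abs_UP_sub_le_snd H hq (BR_mem H hp) (BR_mem H hq)
  have h3 := mul_le_mul_of_nonneg_left (norm_BR_sub_le H hp hq) L₂.coe_nonneg
  have h4 := abs_sub_le (UP p (BR B UA p)) (UP q (BR B UA p)) (UP q (BR B UA q))
  push_cast
  linarith

/-- Uniqueness of the best response leaves nothing to maximize over in the second argument. -/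
theorem stackelbergValue_eq (H : GameAssumptions A B UP UA L₁ L₂ LBR) :
    stackelbergValue A B UP UA = sSup ((fun h => UP h (BR B UA h)) '' A) := by
  unfold stackelbergValue
  congr 1
  ext u
  constructor
  · rintro ⟨h, hh, y, hy, rfl⟩
    exact ⟨h, hh, by
      change UP h (BR B UA h) = UP h y
      rw [(H.existsUnique_bestResponse h hh).unique (BR_mem_bestResponses H hh) hy]⟩
  · rintro ⟨h, hh, rfl⟩
    exact ⟨h, hh, _, BR_mem_bestResponses H hh, rfl⟩

theorem exists_stackelberg_strategy (H : GameAssumptions A B UP UA L₁ L₂ LBR)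
    (hA : IsCompact A) (hne : A.Nonempty) :
    ∃ x ∈ A, stackelbergValue A B UP UA = UP x (BR B UA x) ∧
      ∀ h ∈ A, UP h (BR B UA h) ≤ UP x (BR B UA x) := by
  obtain ⟨x, hx, hmax⟩ := hA.exists_isMaxOn hne (lipschitzOn_UP_BR H).continuousOn
  refine ⟨x, hx, ?_, hmax⟩
  rw [stackelbergValue_eq H]
  exact le_antisymm (csSup_le (hne.image _) (by rintro _ ⟨h, hh, rfl⟩; exact hmax hh))
    (le_csSup ⟨_, by rintro _ ⟨h, hh, rfl⟩; exact hmax hh⟩ ⟨x, hx, rfl⟩)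

theorem UP_BR_le_stackelbergValue (H : GameAssumptions A B UP UA L₁ L₂ LBR)
    (hA : IsCompact A) {h : Euc m} (hh : h ∈ A) :
    UP h (BR B UA h) ≤ stackelbergValue A B UP UA := by
  obtain ⟨x, -, hV, hmax⟩ := exists_stackelberg_strategy H hA ⟨h, hh⟩
  rw [hV]
  exact hmax h hh

/-- Against calibrated forecasts the principal cannot gain much more than the Stackelberg value. -/
theorem sum_utility_le_of_calibrated (H : GameAssumptions A B UP UA L₁ L₂ LBR)
    (hconv : Convex ℝ A) (hA : IsCompact A) (g : Grid A n) {p h : ℕ → A} {s t : ℕ} (hst : s < t)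
    {q : ℝ} (hq0 : 0 ≤ q) (hq : ∀ i, calErr g.tentBinning h p s t i ≤ q) :
    ∑ τ ∈ Finset.Icc s t, UP (h τ) (BR B UA (p τ)) ≤
      ((t : ℝ) + 1 - s) * (stackelbergValue A B UP UA + 2 * g.mesh * (L₁ + L₂ * LBR) +
        L₁ * (Real.sqrt m * n * q)) := by
  set V := stackelbergValue A B UP UA
  set E : ℝ := 2 * g.mesh * (L₁ + L₂ * LBR) with hE
  have hbin : ∀ i, ∑ τ ∈ Finset.Icc s t, g.tentBinning.w i (p τ) * UP (h τ) (BR B UA (p τ)) ≤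
      activations g.tentBinning p s t i * (V + E) +
        L₁ * (Real.sqrt m * (((t : ℝ) - s) * q)) := by
    intro i
    have hcal := activations_mul_norm_le hst (hq i)
    have hL := mul_le_mul_of_nonneg_left hcal L₁.coe_nonneg
    rcases (activations_nonneg g.tentBinning p s t i).eq_or_lt with h0 | h0
    · rw [Finset.sum_eq_zero fun τ hτ => by
        rw [weight_eq_zero_of_activations h0.symm hτ, zero_mul]]
      rw [← h0] at hL ⊢
      linarith
    · have hb := norm_binAverage_sub_pt_le g h0
      have hsum := sum_div_activations h0
      set a := activations g.tentBinning p s t i with ha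
      set b := binAverage g.tentBinning p p s t i with hbdef
      set c := binAverage g.tentBinning p h s t i with hcdef
      set yi := BR B UA (g.pt i) with hyi
      have hyiB : yi ∈ B := BR_mem H (g.pt i).2
      have hwn : ∀ τ ∈ Finset.Icc s t, 0 ≤ g.tentBinning.w i (p τ) / a :=
        fun τ _ => div_nonneg (g.tentBinning.nonneg _ _) h0.le
      have hcA : c ∈ A := hconv.sum_mem hwn hsum fun τ _ => (h τ).2
      -- The only use of concavity in the first argument: the action is frozen at `yi` while the
      -- outcomes are averaged.
      have hjensen : ∑ τ ∈ Finset.Icc s t, g.tentBinning.w i (p τ) / a * UP (h τ) yi ≤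
          UP c yi := by
        have := (H.concave_fst yi hyiB).le_map_sum hwn hsum fun τ _ => (h τ).2
        simp only [smul_eq_mul] at this
        exact this
      -- The mean outcome is moved to the grid point, because `yi` is the best response there and
      -- the payoff is then at most `V`.
      have hUPc : UP c yi ≤ V + L₁ * (‖b - c‖ + 2 * g.mesh) := by
        have h1 := (abs_le.1 (abs_UP_sub_le_fst H hcA (g.pt i).2 hyiB)).2
        have h2 : ‖c - g.pt i‖ ≤ ‖b - c‖ + 2 * g.mesh := by
          have e : c - g.pt i = (b - g.pt i) - (b - c) := by abel
          rw [e]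
          exact (norm_sub_le _ _).trans (by linarith)
        have h3 := mul_le_mul_of_nonneg_left h2 L₁.coe_nonneg
        have h4 : UP (g.pt i) yi ≤ V := UP_BR_le_stackelbergValue H hA (g.pt i).2
        linarith
      have hterm : ∀ τ ∈ Finset.Icc s t,
          g.tentBinning.w i (p τ) * UP (h τ) (BR B UA (p τ)) ≤
          a * (g.tentBinning.w i (p τ) / a * UP (h τ) yi) +
            g.tentBinning.w i (p τ) * (L₂ * (LBR * (2 * g.mesh))) := by
        intro τ _
        have e : a * (g.tentBinning.w i (p τ) / a * UP (h τ) yi) =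
            g.tentBinning.w i (p τ) * UP (h τ) yi := by field_simp
        rw [e, ← mul_add]
        by_cases hw : g.tentBinning.w i (p τ) = 0
        · simp [hw]
        · refine mul_le_mul_of_nonneg_left ?_ (g.tentBinning.nonneg _ _)
          have h1 := (abs_le.1 (abs_UP_sub_le_snd H (h τ).2 (BR_mem H (p τ).2) hyiB)).2
          have h2 := norm_BR_sub_le H (p τ).2 (g.pt i).2
          have h3 := mul_le_mul_of_nonneg_left (norm_sub_pt_le g hw) LBR.coe_nonneg
          have h4 := mul_le_mul_of_nonneg_left (h2.trans h3) L₂.coe_nonneg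
          linarith
      calc _ ≤ ∑ τ ∈ Finset.Icc s t, (a * (g.tentBinning.w i (p τ) / a * UP (h τ) yi) +
            g.tentBinning.w i (p τ) * (L₂ * (LBR * (2 * g.mesh)))) := Finset.sum_le_sum hterm
        _ = a * (∑ τ ∈ Finset.Icc s t, g.tentBinning.w i (p τ) / a * UP (h τ) yi) +
            a * (L₂ * (LBR * (2 * g.mesh))) := by
            rw [Finset.sum_add_distrib, ← Finset.mul_sum, ← Finset.sum_mul]; rfl
        _ ≤ a * (V + L₁ * (‖b - c‖ + 2 * g.mesh)) + a * (L₂ * (LBR * (2 * g.mesh))) := by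
            gcongr
            exact hjensen.trans hUPc
        _ = a * (V + E) + L₁ * (a * ‖b - c‖) := by rw [hE]; ring
        _ ≤ _ := by gcongr
  calc ∑ τ ∈ Finset.Icc s t, UP (h τ) (BR B UA (p τ))
      = ∑ i, ∑ τ ∈ Finset.Icc s t, g.tentBinning.w i (p τ) * UP (h τ) (BR B UA (p τ)) := by
        rw [Finset.sum_comm]
        refine Finset.sum_congr rfl fun τ _ => ?_
        rw [← Finset.sum_mul, g.tentBinning.sum_eq_one, one_mul]
    _ ≤ ∑ i, (activations g.tentBinning p s t i * (V + E) +
          L₁ * (Real.sqrt m * (((t : ℝ) - s) * q))) := Finset.sum_le_sum fun i _ => hbin i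
    _ = ((t : ℝ) + 1 - s) * (V + E) + n * (L₁ * (Real.sqrt m * (((t : ℝ) - s) * q))) := by
        rw [Finset.sum_add_distrib, ← Finset.sum_mul, sum_activations _ _ _ _ hst.le]
        simp
    _ ≤ _ := by
        have : 0 ≤ n * (L₁ * (Real.sqrt m * q)) := by positivity
        nlinarith

end Game

/-! ### Histories and measurability -/

section History

theorem history_apply {A : Type*} (adv fc : Rule A) (t : ℕ) (i : Fin t) :
    history adv fc t i = (outcome adv fc i, forecast adv fc i) := by
  induction t with
  | zero => exact i.elim0
  | succ t ih =>
    refine Fin.lastCases ?_ (fun j => ?_) i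
    · rw [history, Fin.snoc_last]
      rfl
    · rw [history, Fin.snoc_castSucc, ih]
      rfl

variable {A : Type*} [MeasurableSpace A] {Ω Ω' : Type*} [MeasurableSpace Ω] [MeasurableSpace Ω']

theorem measurable_history (adv : Policy A Ω') (fc : Policy A Ω) (t : ℕ) :
    Measurable fun z : Ω × Ω' => history (adv.rule z.2) (fc.rule z.1) t := by
  induction t with
  | zero => exact measurable_pi_iff.2 fun i => i.elim0
  | succ t ih =>
    refine measurable_pi_iff.2 fun i => ?_
    refine Fin.lastCases ?_ (fun j => ?_) i
    · simp only [history, Fin.snoc_last]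
      exact ((adv.measurable_rule t).comp (measurable_snd.prodMk ih)).prodMk
        ((fc.measurable_rule t).comp (measurable_fst.prodMk ih))
    · simp only [history, Fin.snoc_castSucc]
      exact (measurable_pi_iff.1 ih) j

theorem measurable_outcome (adv : Policy A Ω') (fc : Policy A Ω) (t : ℕ) :
    Measurable fun z : Ω × Ω' => outcome (adv.rule z.2) (fc.rule z.1) t :=
  (adv.measurable_rule t).comp (measurable_snd.prodMk (measurable_history adv fc t))

theorem measurable_forecast (adv : Policy A Ω') (fc : Policy A Ω) (t : ℕ) :
    Measurable fun z : Ω × Ω' => forecast (adv.rule z.2) (fc.rule z.1) t :=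
  (fc.measurable_rule t).comp (measurable_fst.prodMk (measurable_history adv fc t))

end History

/-! ### The calibration event against randomized principals -/

section CalibrationEvent

variable {m n : ℕ} {A : Set (Euc m)}

theorem measurable_tentBinning (g : Grid A n) (i : Fin n) : Measurable (g.tentBinning.w i) := by
  have h : ∀ j, Measurable fun p : A => tent (p : Euc m) (g.pt j) (2 * g.mesh) := by
    intro j
    unfold tent
    fun_prop
  change Measurable fun p : A => tent (p : Euc m) (g.pt i) (2 * g.mesh) / g.total p
  exact (h i).div (Finset.measurable_fun_sum _ fun j _ => h j)

theorem measurable_calErr {Z : Type*} [MeasurableSpace Z] {W : Binning A n}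
    (hW : ∀ i, Measurable (W.w i)) {h p : Z → ℕ → A} (hh : ∀ t, Measurable fun z => h z t)
    (hp : ∀ t, Measurable fun z => p z t) (s t : ℕ) (i : Fin n) :
    Measurable fun z => calErr W (h z) (p z) s t i := by
  have hw : ∀ τ, Measurable fun z => W.w i (p z τ) := fun τ => (hW i).comp (hp τ)
  have hact : Measurable fun z => activations W (p z) s t i :=
    Finset.measurable_fun_sum _ fun τ _ => hw τ
  have hav : ∀ {v : Z → ℕ → A}, (∀ t, Measurable fun z => v z t) →
      Measurable fun z => binAverage W (p z) (v z) s t i := fun hv =>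
    Finset.measurable_fun_sum _ fun τ _ =>
      ((hw τ).div hact).smul (measurable_subtype_coe.comp (hv τ))
  have hof : Continuous fun v : Euc m => WithLp.ofLp v := by fun_prop
  exact (hact.div_const _).mul (hof.measurable.comp ((hav hp).sub (hav hh))).norm

variable {Ω Ω' : Type*} [MeasurableSpace Ω] [MeasurableSpace Ω']

/-- The event that the calibration bound `q` fails on some interval of the first `T` rounds. -/
def miscalibrated (W : Binning A n) (σ : Policy A Ω) (adv : Policy A Ω') (T : ℕ) (q : ℕ → ℝ) :
    Set (Ω × Ω') :=
  {z | ∀ s t, s < t → t < T → ∀ i, calErr W (outcome (adv.rule z.2) (σ.rule z.1))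
    (forecast (adv.rule z.2) (σ.rule z.1)) s t i ≤ q (t - s)}ᶜ

theorem measurableSet_miscalibrated {W : Binning A n} (hW : ∀ i, Measurable (W.w i))
    (σ : Policy A Ω) (adv : Policy A Ω') (T : ℕ) (q : ℕ → ℝ) :
    MeasurableSet (miscalibrated W σ adv T q) := by
  refine MeasurableSet.compl ?_
  simp only [ofPred_forall]
  refine MeasurableSet.iInter fun s => MeasurableSet.iInter fun t => MeasurableSet.iInter fun _ =>
    MeasurableSet.iInter fun _ => MeasurableSet.iInter fun i => measurableSet_le ?_
      measurable_const
  exact measurable_calErr hW (measurable_outcome adv σ) (measurable_forecast adv σ) s t i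

/-- Calibration is assumed against deterministic adversaries only. Once the principal's seed is
fixed the policy is such an adversary, and Fubini extends the bound to independent seeds. -/
theorem measure_miscalibrated_le {μ : Measure Ω} [IsProbabilityMeasure μ] {ν : Measure Ω'}
    [IsProbabilityMeasure ν] {W : Binning A n} (hW : ∀ i, Measurable (W.w i))
    {σ : Policy A Ω} {T : ℕ} {r : ℝ → ℕ → ℝ} (hσ : AdaptivelyCalibrated μ σ T 0 W r)
    (adv : Policy A Ω') {δ : ℝ} (hδ : δ ∈ Ioo (0 : ℝ) 1) :
    (μ.prod ν) (miscalibrated W σ adv T (r δ)) ≤ ENNReal.ofReal δ := by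
  have hmeas := measurableSet_miscalibrated hW σ adv T (r δ)
  rw [Measure.prod_apply_symm hmeas]
  calc _ ≤ ∫⁻ _ : Ω', ENNReal.ofReal δ ∂ν := by
        refine lintegral_mono fun ω' => ?_
        have hrule : ∀ t, Measurable (adv.rule ω' t) := fun t =>
          (adv.measurable_rule t).comp measurable_prodMk_left
        have h := hσ (adv.rule ω') hrule δ hδ
        have hslice : MeasurableSet ((fun ω => (ω, ω')) ⁻¹' miscalibrated W σ adv T (r δ)) :=
          measurable_prodMk_right hmeas
        have hcompl := prob_compl_eq_one_sub (μ := μ) hslice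
        have heq : {ω | ∀ s t, s < t → t < T → ∀ i, calErr W (outcome (adv.rule ω') (σ.rule ω))
            (forecast (adv.rule ω') (σ.rule ω)) s t i ≤ r δ (t - s) + 0} =
            ((fun ω => (ω, ω')) ⁻¹' miscalibrated W σ adv T (r δ))ᶜ := by
          simp only [miscalibrated, preimage_compl, compl_compl, add_zero]
          rfl
        rw [heq, hcompl] at h
        have h1 := tsub_le_iff_right.1 h
        refine ENNReal.le_of_add_le_add_left (a := 1 - μ ((fun ω => (ω, ω')) ⁻¹'
          miscalibrated W σ adv T (r δ))) (ne_top_of_le_ne_top ENNReal.one_ne_top tsub_le_self) ?_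
        rwa [tsub_add_cancel_of_le prob_le_one]
    _ = ENNReal.ofReal δ := by simp

end CalibrationEvent

/-! ### The upper bound -/

section UpperBound

variable {m k n : ℕ} {A : Set (Euc m)} {B : Set (Euc k)} {UP UA : Euc m → Euc k → ℝ}
  {L₁ L₂ LBR : ℝ≥0} {Ω Ω' : Type*} [MeasurableSpace Ω] [MeasurableSpace Ω']

/-- A sequence of probabilities tends to zero if for every `δ` it is eventually at most `δ`. -/
theorem tendsto_zero_of_eventually_le_ofReal {a : ℕ → ℝ≥0∞}
    (h : ∀ δ ∈ Ioo (0 : ℝ) 1, ∀ᶠ j in atTop, a j ≤ ENNReal.ofReal δ) :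
    Tendsto a atTop (𝓝 0) := by
  rw [ENNReal.tendsto_nhds_zero]
  intro ε hε
  obtain ⟨δ, hδ0, hδε⟩ : ∃ δ : ℝ, 0 < δ ∧ ENNReal.ofReal δ ≤ ε := by
    rcases eq_or_ne ε ⊤ with rfl | htop
    · exact ⟨1, one_pos, le_top⟩
    · exact ⟨ε.toReal, ENNReal.toReal_pos hε.ne' htop, ENNReal.ofReal_toReal_le⟩
  filter_upwards [h (min δ (1 / 2)) ⟨by positivity, by
    linarith [min_le_right δ (1 / 2 : ℝ)]⟩] with j hj
  exact hj.trans ((ENNReal.ofReal_le_ofReal (min_le_left _ _)).trans hδε)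

/-- For large `T`, `sum_utility_le_of_calibrated` on the whole horizon keeps the payoff below the
threshold whenever calibration holds, so an excess has probability at most `δ`. -/
theorem tendsto_measure_gt_stackelbergValue (hA_conv : Convex ℝ A) (hA_cpt : IsCompact A)
    (g : Grid A n) {ε₀ : ℝ} (hg : 2 * g.mesh * (L₁ + L₂ * LBR) < ε₀)
    (H : GameAssumptions A B UP UA L₁ L₂ LBR) (μ : Measure Ω) [IsProbabilityMeasure μ]
    (σ : ℕ → Policy A Ω) (r : ℝ → ℕ → ℕ → ℝ)
    (hσ : ∀ T, AdaptivelyCalibrated μ (σ T) T 0 g.tentBinning (fun δ => r δ T))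
    (hr : ∀ δ ∈ Ioo (0 : ℝ) 1, Tendsto (fun T => r δ T (T - 1)) atTop (𝓝 0))
    (ν : Measure Ω') [IsProbabilityMeasure ν] (adv : ℕ → Policy A Ω') :
    Tendsto (fun T => (μ.prod ν) {z | stackelbergValue A B UP UA + ε₀ <
      avgUtility UP UA B ((adv T).rule z.2) ((σ T).rule z.1) T}) atTop (𝓝 0) := by
  refine tendsto_zero_of_eventually_le_ofReal fun δ hδ => ?_
  have hlim : Tendsto (fun T => 2 * g.mesh * (L₁ + L₂ * LBR) +
      L₁ * (Real.sqrt m * n * |r δ T (T - 1)|)) atTop (𝓝 (2 * g.mesh * (L₁ + L₂ * LBR) +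
      L₁ * (Real.sqrt m * n * |0|))) :=
    (((hr δ hδ).abs.const_mul _).const_mul _).const_add _
  rw [abs_zero, mul_zero, mul_zero, add_zero] at hlim
  filter_upwards [hlim.eventually_lt_const hg, eventually_ge_atTop 2] with T hT hT2
  refine le_trans (measure_mono ?_) (measure_miscalibrated_le
    (fun i => measurable_tentBinning g i) (hσ T) (adv T) hδ)
  intro z hz
  by_contra hcal
  rw [miscalibrated, notMem_compl_iff] at hcal
  have hsum := sum_utility_le_of_calibrated H hA_conv hA_cpt g (s := 0) (t := T - 1) (by omega)
    (abs_nonneg (r δ T (T - 1)))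
    (fun i => (hcal 0 (T - 1) (by omega) (by omega) i).trans (le_abs_self _))
  have hT1 : Finset.Icc 0 (T - 1) = Finset.range T := by
    ext τ
    simp only [Finset.mem_Icc, Finset.mem_range]
    omega
  have hT0 : (0 : ℝ) < T := by
    have : (2 : ℝ) ≤ T := by exact_mod_cast hT2
    linarith
  rw [hT1, Nat.cast_sub (by omega)] at hsum
  have hz' : stackelbergValue A B UP UA + ε₀ < _ := hz
  rw [avgUtility, lt_div_iff₀ hT0] at hz'
  have h2 := hz'.trans_le hsum
  have h3 : (stackelbergValue A B UP UA + ε₀) * T < T * (stackelbergValue A B UP UA + ε₀) := by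
    refine h2.trans_le ?_
    push_cast
    rw [show (T : ℝ) - 1 + 1 - 0 = T by ring]
    exact mul_le_mul_of_nonneg_left (by linarith) hT0.le
  linarith

end UpperBound

/-! ### A second-moment bound for sums driven by independent variables -/

section SecondMoment

theorem abs_sum_increments_le {𝕊 E : Type*} {G : ℕ → (ℕ → 𝕊) → E} {F : E × 𝕊 → ℝ} {K : ℝ} (hK : ∀ z, |F z| ≤ K)
    (N : ℕ) (a : ℕ → 𝕊) :
    |∑ φ ∈ Finset.range N, F (G φ a, a φ)| ≤ N * K :=
  (Finset.abs_sum_le_sum_abs _ _).trans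
    ((Finset.sum_le_sum fun _ _ => hK _).trans (le_of_eq (by simp)))

variable {𝕊 E Ω : Type*} [MeasurableSpace 𝕊] [MeasurableSpace E] [MeasurableSpace Ω]
  {ν : Measure Ω} [IsProbabilityMeasure ν] {κ : Measure 𝕊} {S : ℕ → Ω → 𝕊}

/-- A function of the variables before time `φ` and of the variable at time `φ` has mean zero if
its conditional means given the past vanish. -/
theorem integral_past_present_eq_zero [Nonempty 𝕊] [IsProbabilityMeasure κ]
    (hS : ∀ φ, Measurable (S φ)) (hind : iIndepFun S ν) (hmap : ∀ φ, ν.map (S φ) = κ) (φ : ℕ)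
    {H : (ℕ → 𝕊) × 𝕊 → ℝ} (hH : Measurable H) {C : ℝ} (hC : ∀ z, |H z| ≤ C)
    (hpast : ∀ a a' : ℕ → 𝕊, (∀ i < φ, a i = a' i) → ∀ s, H (a, s) = H (a', s))
    (hzero : ∀ a, ∫ s, H (a, s) ∂κ = 0) :
    ∫ ω, H (fun i => S i ω, S φ ω) ∂ν = 0 := by
  classical
  obtain ⟨s₀⟩ := (inferInstance : Nonempty 𝕊)
  -- The finite past is padded by an arbitrary value, which `hpast` makes irrelevant; `H` thus
  -- becomes a function of two independent variables.
  let ext : (Finset.range φ → 𝕊) → ℕ → 𝕊 := fun a i =>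
    if h : i ∈ Finset.range φ then a ⟨i, h⟩ else s₀
  have hext : Measurable ext := by
    refine measurable_pi_iff.2 fun i => ?_
    by_cases h : i ∈ Finset.range φ
    · simp only [ext, h, dite_true]
      exact measurable_pi_apply _
    · simp only [ext, h, dite_false]
      exact measurable_const
  let U : Ω → (Finset.range φ → 𝕊) := fun ω i => S i ω
  have hU : Measurable U := measurable_pi_iff.2 fun i => hS i
  have hindep : IndepFun U (S φ) ν :=
    (hind.indepFun_finset (Finset.range φ) {φ} (by simp) hS).comp (φ := id)
      (ψ := fun a : ({φ} : Finset ℕ) → 𝕊 => a ⟨φ, by simp⟩) measurable_id (measurable_pi_apply _)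
  have hprod := (indepFun_iff_map_prod_eq_prod_map_map hU.aemeasurable (hS φ).aemeasurable).1 hindep
  have : IsProbabilityMeasure (ν.map U) := Measure.isProbabilityMeasure_map hU.aemeasurable
  let H' : (Finset.range φ → 𝕊) × 𝕊 → ℝ := fun z => H (ext z.1, z.2)
  have hH' : Measurable H' := hH.comp ((hext.comp measurable_fst).prodMk measurable_snd)
  calc ∫ ω, H (fun i => S i ω, S φ ω) ∂ν = ∫ ω, H' (U ω, S φ ω) ∂ν := by
        refine integral_congr_ae (ae_of_all _ fun ω => hpast _ _ (fun i hi => ?_) _)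
        simp [ext, U, hi]
    _ = ∫ z, H' z ∂(ν.map U).prod κ := by
        rw [← hmap φ, ← hprod, integral_map (hU.prodMk (hS φ)).aemeasurable
          hH'.aestronglyMeasurable]
    _ = ∫ a, ∫ s, H' (a, s) ∂κ ∂ν.map U := integral_prod _ <|
        Integrable.of_bound hH'.aestronglyMeasurable C (ae_of_all _ fun z => hC _)
    _ = 0 := by simp [H', hzero]

variable {G : ℕ → (ℕ → 𝕊) → E} {F : E × 𝕊 → ℝ}

theorem measurable_sum_increments (hG : ∀ φ, Measurable (G φ)) (hF : Measurable F) (N : ℕ) :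
    Measurable fun a : ℕ → 𝕊 => ∑ φ ∈ Finset.range N, F (G φ a, a φ) :=
  Finset.measurable_fun_sum _ fun φ _ => hF.comp ((hG φ).prodMk (measurable_pi_apply φ))

/-- Martingale increments are orthogonal: in the square of a partial sum plus a new term, the cross
term has mean zero, so second moments add. -/
theorem integral_sq_sum_increments_le [Nonempty 𝕊] [IsProbabilityMeasure κ]
    (hS : ∀ φ, Measurable (S φ)) (hind : iIndepFun S ν) (hmap : ∀ φ, ν.map (S φ) = κ)
    (hG : ∀ φ, Measurable (G φ))
    (hpast : ∀ φ (a a' : ℕ → 𝕊), (∀ i < φ, a i = a' i) → G φ a = G φ a')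
    (hF : Measurable F) {K : ℝ} (hK : ∀ z, |F z| ≤ K) (hzero : ∀ x, ∫ s, F (x, s) ∂κ = 0)
    (N : ℕ) :
    ∫ ω, (∑ φ ∈ Finset.range N, F (G φ (fun i => S i ω), S φ ω)) ^ 2 ∂ν ≤ N * K ^ 2 := by
  have hSm : Measurable fun ω => fun i => S i ω := measurable_pi_iff.2 hS
  induction N with
  | zero => simp
  | succ N ih =>
    let P : (ℕ → 𝕊) → ℝ := fun a => ∑ φ ∈ Finset.range N, F (G φ a, a φ)
    have hP : Measurable P := measurable_sum_increments hG hF N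
    have hPb : ∀ a, |P a| ≤ N * K := abs_sum_increments_le hK N
    let H : (ℕ → 𝕊) × 𝕊 → ℝ := fun z => P z.1 * F (G N z.1, z.2)
    have hH : Measurable H := (hP.comp measurable_fst).mul
      (hF.comp (((hG N).comp measurable_fst).prodMk measurable_snd))
    have hHb : ∀ z, |H z| ≤ N * K * K := fun z => by
      rw [abs_mul]
      exact mul_le_mul (hPb _) (hK _) (abs_nonneg _) ((abs_nonneg _).trans (hPb z.1))
    -- The partial sum involves earlier variables only, and factors out of the conditional mean of
    -- the new increment.
    have hcross : ∫ ω, H (fun i => S i ω, S N ω) ∂ν = 0 := by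
      refine integral_past_present_eq_zero hS hind hmap N hH hHb (fun a a' h s => ?_) fun a => ?_
      · have h1 : P a = P a' := Finset.sum_congr rfl fun φ hφ => by
          have hφ' := Finset.mem_range.1 hφ
          rw [hpast φ a a' fun i hi => h i (hi.trans hφ'), h φ hφ']
        simp only [H, h1, hpast N a a' h]
      · simp only [H]
        rw [integral_const_mul, hzero, mul_zero]
    have hFN : Measurable fun ω => F (G N (fun i => S i ω), S N ω) :=
      hF.comp (((hG N).comp hSm).prodMk (hS N))
    have i1 : Integrable (fun ω => (P fun i => S i ω) ^ 2) ν :=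
      Integrable.of_bound ((hP.comp hSm).pow_const 2).aestronglyMeasurable ((N * K) ^ 2)
        (ae_of_all _ fun ω => by
          rw [Real.norm_eq_abs, abs_pow]; exact pow_le_pow_left₀ (abs_nonneg _) (hPb _) 2)
    have i2 : Integrable (fun ω => H (fun i => S i ω, S N ω)) ν :=
      Integrable.of_bound (hH.comp (hSm.prodMk (hS N))).aestronglyMeasurable (N * K * K)
        (ae_of_all _ fun ω => hHb _)
    have hF2 : ∀ ω, (F (G N (fun i => S i ω), S N ω)) ^ 2 ≤ K ^ 2 := fun ω => by
      rw [← sq_abs]; exact pow_le_pow_left₀ (abs_nonneg _) (hK _) 2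
    have i3 : Integrable (fun ω => (F (G N (fun i => S i ω), S N ω)) ^ 2) ν :=
      Integrable.of_bound (hFN.pow_const 2).aestronglyMeasurable (K ^ 2)
        (ae_of_all _ fun ω => by
          rw [Real.norm_of_nonneg (sq_nonneg _)]; exact hF2 ω)
    have h3 : ∫ ω, (F (G N (fun i => S i ω), S N ω)) ^ 2 ∂ν ≤ K ^ 2 := by
      refine (integral_mono i3 (integrable_const _) hF2).trans (le_of_eq ?_)
      simp
    have hexp : ∀ ω, (∑ φ ∈ Finset.range (N + 1), F (G φ (fun i => S i ω), S φ ω)) ^ 2 =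
        ((P fun i => S i ω) ^ 2 + 2 * H (fun i => S i ω, S N ω)) +
          (F (G N (fun i => S i ω), S N ω)) ^ 2 := fun ω => by
      rw [Finset.sum_range_succ]
      simp only [P, H]
      ring
    have i12 : Integrable (fun ω => (P fun i => S i ω) ^ 2 + 2 * H (fun i => S i ω, S N ω)) ν :=
      i1.add (i2.const_mul 2)
    simp only [hexp]
    rw [integral_add i12 i3, integral_add i1 (i2.const_mul 2), integral_const_mul, hcross]
    push_cast
    linarith

/-- Chebyshev's inequality for a sum of bounded martingale increments. -/
theorem measure_le_abs_sum_increments [Nonempty 𝕊] [IsProbabilityMeasure κ]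
    (hS : ∀ φ, Measurable (S φ)) (hind : iIndepFun S ν) (hmap : ∀ φ, ν.map (S φ) = κ)
    (hG : ∀ φ, Measurable (G φ))
    (hpast : ∀ φ (a a' : ℕ → 𝕊), (∀ i < φ, a i = a' i) → G φ a = G φ a')
    (hF : Measurable F) {K : ℝ} (hK : ∀ z, |F z| ≤ K) (hzero : ∀ x, ∫ s, F (x, s) ∂κ = 0)
    {N : ℕ} (hN : 0 < N) {c : ℝ} (hc : 0 < c) :
    ν {ω | c * N < |∑ φ ∈ Finset.range N, F (G φ (fun i => S i ω), S φ ω)|} ≤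
      ENNReal.ofReal (K ^ 2 / c ^ 2 / N) := by
  have hSm : Measurable fun ω => fun i => S i ω := measurable_pi_iff.2 hS
  have hN' : (0 : ℝ) < N := by exact_mod_cast hN
  let Q : Ω → ℝ := fun ω => (∑ φ ∈ Finset.range N, F (G φ (fun i => S i ω), S φ ω)) ^ 2
  have hQ : Measurable Q := ((measurable_sum_increments hG hF N).comp hSm).pow_const 2
  have hQi : Integrable Q ν := Integrable.of_bound hQ.aestronglyMeasurable ((N * K) ^ 2)
    (ae_of_all _ fun ω => by
      rw [Real.norm_eq_abs, abs_pow]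
      exact pow_le_pow_left₀ (abs_nonneg _)
        (abs_sum_increments_le (G := G) hK N fun i => S i ω) 2)
  have hmarkov := mul_meas_ge_le_integral_of_nonneg (ae_of_all ν fun ω => sq_nonneg _ : 0 ≤ᵐ[ν] Q)
    hQi ((c * N) ^ 2)
  have hle := hmarkov.trans (integral_sq_sum_increments_le hS hind hmap hG hpast hF hK hzero N)
  have hreal : ν.real {ω | (c * N) ^ 2 ≤ Q ω} ≤ K ^ 2 / c ^ 2 / N := by
    rw [div_div, le_div_iff₀ (by positivity)]
    have : (c * N) ^ 2 * ν.real {ω | (c * N) ^ 2 ≤ Q ω} =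
      N * (ν.real {ω | (c * N) ^ 2 ≤ Q ω} * (c ^ 2 * N)) := by ring
    rw [this] at hle
    exact le_of_mul_le_mul_left hle hN'
  refine (measure_mono fun ω hω => ?_).trans
    ((ENNReal.le_ofReal_iff_toReal_le (measure_ne_top ν {ω | (c * N) ^ 2 ≤ Q ω})
      (by positivity)).2 hreal)
  have hω' : c * N < |∑ φ ∈ Finset.range N, F (G φ (fun i => S i ω), S φ ω)| := hω
  change (c * N) ^ 2 ≤ (∑ φ ∈ Finset.range N, F (G φ (fun i => S i ω), S φ ω)) ^ 2
  rw [← sq_abs (∑ φ ∈ _, _)]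
  exact pow_le_pow_left₀ (by positivity) hω'.le 2

end SecondMoment

/-! ### Structure of lazy gradient descent -/

section LazyGDStructure

variable {m k : ℕ} {A : Set (Euc m)} {B : Set (Euc k)} {UP UA : Euc m → Euc k → ℝ}

/-- Causality of the algorithm: the center of an epoch uses nothing from that epoch or later. -/
theorem lazyGDCenter_congr (θ : LazyGDParams A) (init : shrink A θ.radius) (M : ℕ)
    {S S' : ℕ → Metric.sphere (0 : Euc m) 1} {y y' : ℕ → Euc k} {φ : ℕ}
    (hS : ∀ i < φ, S i = S' i) (hy : ∀ τ < φ * M, y τ = y' τ) :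
    lazyGDCenter UP θ init M S y φ = lazyGDCenter UP θ init M S' y' φ := by
  induction φ with
  | zero => rfl
  | succ φ ih =>
    have hsum : ∑ s ∈ Finset.range M, y (φ * M + s) = ∑ s ∈ Finset.range M, y' (φ * M + s) :=
      Finset.sum_congr rfl fun s hs => hy _ (by
        have := Finset.mem_range.1 hs
        rw [Nat.succ_mul]
        omega)
    have hc := ih (fun i hi => hS i (by omega)) fun τ hτ => hy τ (by
      rw [Nat.succ_mul]; omega)
    simp only [lazyGDCenter, hsum, hc, hS φ (by omega)]

/-- The centers visited by the algorithm when it faces the forecasting rule `fc`. -/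
def lazyGDPath (UP UA : Euc m → Euc k → ℝ) (B : Set (Euc k)) (θ : LazyGDParams A)
    (init : shrink A θ.radius) (M : ℕ) (S : ℕ → Metric.sphere (0 : Euc m) 1) (fc : Rule A) :
    ℕ → shrink A θ.radius :=
  lazyGDCenter UP θ init M S fun τ =>
    BR B UA (forecast (lazyGD UP UA B θ init M S) fc τ : A)

/-- The rule sees a truncated action sequence and `lazyGDPath` the full one. They agree on the
rounds of completed epochs, which alone determine the center. -/
theorem outcome_lazyGD (θ : LazyGDParams A) (init : shrink A θ.radius) (M : ℕ)
    (S : ℕ → Metric.sphere (0 : Euc m) 1) (fc : Rule A) (t : ℕ) :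
    outcome (lazyGD UP UA B θ init M S) fc t =
      query θ (lazyGDPath UP UA B θ init M S fc (t / M)) (S (t / M)) := by
  unfold outcome
  conv_lhs => unfold lazyGD
  simp only [lazyGDPath]
  congr 1
  refine lazyGDCenter_congr θ init M (fun _ _ => rfl) fun τ hτ => ?_
  have hlt : τ < t := hτ.trans_le (Nat.div_mul_le_self t M)
  rw [dif_pos hlt, history_apply]
  rfl

theorem lazyGD_congr (θ : LazyGDParams A) (init : shrink A θ.radius) (M : ℕ)
    {S S' : ℕ → Metric.sphere (0 : Euc m) 1} {t : ℕ} (hS : ∀ i ≤ t / M, S i = S' i)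
    (past : Fin t → A × A) :
    lazyGD UP UA B θ init M S t past = lazyGD UP UA B θ init M S' t past := by
  simp only [lazyGD, hS _ le_rfl]
  rw [lazyGDCenter_congr θ init M (fun i hi => hS i hi.le) fun _ _ => rfl]

/-- The first `t` rounds touch only epochs that start before round `t`. The forecasting rule is the
same on both sides, so agreement propagates round by round. -/
theorem history_lazyGD_congr (θ : LazyGDParams A) (init : shrink A θ.radius) (M : ℕ)
    {S S' : ℕ → Metric.sphere (0 : Euc m) 1} (fc : Rule A) {t : ℕ}
    (hS : ∀ i, i * M < t → S i = S' i) :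
    history (lazyGD UP UA B θ init M S) fc t = history (lazyGD UP UA B θ init M S') fc t := by
  induction t with
  | zero => exact funext fun i => i.elim0
  | succ t ih =>
    have h1 := ih fun i hi => hS i (Nat.lt_succ_of_lt hi)
    have h2 : ∀ past, lazyGD UP UA B θ init M S t past = lazyGD UP UA B θ init M S' t past :=
      lazyGD_congr θ init M fun i hi => hS i
        (Nat.lt_succ_of_le ((Nat.mul_le_mul_right M hi).trans (Nat.div_mul_le_self t M)))
    rw [history, history, h1, h2]

/-- The center of an epoch depends only on the directions drawn in earlier epochs. -/
theorem lazyGDPath_congr (θ : LazyGDParams A) (init : shrink A θ.radius) (M : ℕ)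
    {S S' : ℕ → Metric.sphere (0 : Euc m) 1} (fc : Rule A) {φ : ℕ} (hS : ∀ i < φ, S i = S' i) :
    lazyGDPath UP UA B θ init M S fc φ = lazyGDPath UP UA B θ init M S' fc φ := by
  refine lazyGDCenter_congr θ init M hS fun τ hτ => ?_
  simp only [forecast]
  rw [history_lazyGD_congr θ init M fc fun i hi => hS i ?_]
  exact lt_of_mul_lt_mul_right (hi.trans hτ) (Nat.zero_le M)

end LazyGDStructure

/-! ### Measurability of lazy gradient descent -/

section LazyGDMeasurable

variable {m k : ℕ} {A : Set (Euc m)} {B : Set (Euc k)} {UP UA : Euc m → Euc k → ℝ}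
  {L₁ L₂ LBR : ℝ≥0}

theorem continuous_UP (H : GameAssumptions A B UP UA L₁ L₂ LBR) :
    Continuous fun z : A × B => UP z.1 z.2 := by
  have h : ContinuousOn (fun z : Euc m × Euc k => UP z.1 z.2) (A ×ˢ B) :=
    continuousOn_prod_of_continuousOn_lipschitzOnWith (fun z : Euc m × Euc k => UP z.1 z.2) L₁
      (fun a ha => (H.lipschitz_snd a ha).continuousOn) H.lipschitz_fst
  exact h.comp_continuous (f := fun z : A × B => ((z.1 : Euc m), (z.2 : Euc k))) (by fun_prop)
    fun z => ⟨z.1.2, z.2.2⟩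

theorem continuous_BR (H : GameAssumptions A B UP UA L₁ L₂ LBR) :
    Continuous fun p : A => BR B UA p :=
  H.lipschitz_BR.continuousOn.comp_continuous continuous_subtype_val fun p => p.2

theorem continuous_query (θ : LazyGDParams A) :
    Continuous fun z : shrink A θ.radius × Metric.sphere (0 : Euc m) 1 => query θ z.1 z.2 := by
  unfold query
  fun_prop

theorem average_mem {E : Type*} [AddCommGroup E] [Module ℝ E] {B : Set E} (hB : Convex ℝ B)
    {M : ℕ} (hM : 0 < M) {y : ℕ → E} (hy : ∀ s < M, y s ∈ B) :
    (M : ℝ)⁻¹ • ∑ s ∈ Finset.range M, y s ∈ B := by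
  have hM' : (M : ℝ) ≠ 0 := by positivity
  rw [Finset.smul_sum]
  exact hB.sum_mem (fun _ _ => by positivity) (by simp [hM'])
    fun s hs => hy s (Finset.mem_range.1 hs)

variable {Z : Type*} [MeasurableSpace Z]

/-- A center is a continuous function of the previous center, direction and average action. The
utility is known to be continuous only on `A × B`, so the average must stay in the convex set `B`;
hence the conditions on `M` and on the actions. -/
theorem measurable_lazyGDCenter (H : GameAssumptions A B UP UA L₁ L₂ LBR) (hA : Convex ℝ A)
    (hA' : IsClosed A) (θ : LazyGDParams A) (init : shrink A θ.radius) {M : ℕ} (hM : 0 < M)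
    {S : ℕ → Z → Metric.sphere (0 : Euc m) 1} (hS : ∀ φ, Measurable (S φ)) {y : ℕ → Z → Euc k}
    (hy : ∀ τ, Measurable (y τ)) {φ : ℕ} (hyB : ∀ τ < φ * M, ∀ z, y τ z ∈ B) :
    Measurable fun z => lazyGDCenter UP θ init M (fun φ => S φ z) (fun τ => y τ z) φ := by
  induction φ with
  | zero => exact measurable_const
  | succ φ ih =>
    have hc := ih fun τ hτ => hyB τ (by rw [Nat.succ_mul]; omega)
    have : Nonempty (shrink A θ.radius) := ⟨init⟩
    have hav : Measurable fun z => (M : ℝ)⁻¹ • ∑ s ∈ Finset.range M, y (φ * M + s) z :=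
      (Finset.measurable_fun_sum (Finset.range M) fun s _ => hy (φ * M + s)).const_smul (M : ℝ)⁻¹
    have havB : ∀ z, (M : ℝ)⁻¹ • ∑ s ∈ Finset.range M, y (φ * M + s) z ∈ B := fun z =>
      average_mem H.convex_actions hM fun s hs => hyB _ (by rw [Nat.succ_mul]; omega) z
    have hq := (continuous_query θ).measurable.comp (hc.prodMk (hS φ))
    have hU := (continuous_UP H).measurable.comp (hq.prodMk (hav.subtype_mk (h := havB)))
    have hstep : Measurable fun z => θ.step φ * ((m : ℝ) / θ.radius *
        UP (query θ (lazyGDCenter UP θ init M (fun φ => S φ z) (fun τ => y τ z) φ) (S φ z))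
          ((M : ℝ)⁻¹ • ∑ s ∈ Finset.range M, y (φ * M + s) z)) :=
      (hU.const_mul _).const_mul _
    exact (continuous_nearest (isClosed_shrink hA' θ.radius)
      (convex_shrink hA θ.radius)).measurable.comp
        ((measurable_subtype_coe.comp hc).add
          (hstep.smul (measurable_subtype_coe.comp (hS φ))))

/-- Lazy gradient descent as a policy whose seed determines the directions. -/
def lazyGDPolicy (H : GameAssumptions A B UP UA L₁ L₂ LBR) (hA : Convex ℝ A) (hA' : IsClosed A)
    (θ : LazyGDParams A) (init : shrink A θ.radius) {M : ℕ} (hM : 0 < M)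
    (S : ℕ → Z → Metric.sphere (0 : Euc m) 1) (hS : ∀ φ, Measurable (S φ)) : Policy A Z where
  rule z := lazyGD UP UA B θ init M fun φ => S φ z
  measurable_rule t := by
    refine (continuous_query θ).measurable.comp (Measurable.prodMk ?_ ((hS _).comp measurable_fst))
    refine measurable_lazyGDCenter H hA hA' θ init hM (fun φ => (hS φ).comp measurable_fst)
      (y := fun τ (z : Z × (Fin t → A × A)) => if hτ : τ < t then BR B UA (z.2 ⟨τ, hτ⟩).2 else 0) (fun τ => ?_)
      fun τ hτ z => ?_
    · by_cases hτ : τ < t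
      · simp only [hτ, dite_true]
        exact (continuous_BR H).measurable.comp
          (measurable_snd.comp ((measurable_pi_apply _).comp measurable_snd))
      · simp only [hτ, dite_false]
        exact measurable_const
    -- The center of the current epoch reads only rounds before `t`, so the default action `0`,
    -- which need not lie in `B`, does not occur.
    · have hlt : τ < t := hτ.trans_le (Nat.div_mul_le_self t M)
      simp only [hlt, dite_true]
      exact BR_mem H (z.2 ⟨τ, hlt⟩).2.2

theorem measurable_lazyGDPath {Ω : Type*} [MeasurableSpace Ω]
    (H : GameAssumptions A B UP UA L₁ L₂ LBR) (hA : Convex ℝ A) (hA' : IsClosed A)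
    (θ : LazyGDParams A) (init : shrink A θ.radius) {M : ℕ} (hM : 0 < M)
    {S : ℕ → Z → Metric.sphere (0 : Euc m) 1} (hS : ∀ φ, Measurable (S φ)) (σ : Policy A Ω)
    (φ : ℕ) :
    Measurable fun z : Ω × Z =>
      lazyGDPath UP UA B θ init M (fun φ => S φ z.2) (σ.rule z.1) φ :=
  measurable_lazyGDCenter H hA hA' θ init hM (fun φ => (hS φ).comp measurable_snd)
    (fun τ => (continuous_BR H).measurable.comp
      (measurable_forecast (lazyGDPolicy H hA hA' θ init hM S hS) σ τ))
    fun _ _ z => BR_mem H (forecast _ (σ.rule z.1) _ : A).2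

end LazyGDMeasurable

/-! ### The one-point gradient estimate -/

section OnePoint

variable {m : ℕ} {A : Set (Euc m)}

/-- The component of the one-point gradient estimate of `f` at the center `z.1` with direction
`z.2` along the displacement to `w`. -/
def onePoint (θ : LazyGDParams A) (f : Euc m → ℝ) (w : Euc m)
    (z : shrink A θ.radius × Metric.sphere (0 : Euc m) 1) : ℝ :=
  (m : ℝ) / θ.radius * (f (query θ z.1 z.2) * inner ℝ (z.2 : Euc m) (w - z.1))

/-- The centered one-point estimate. -/
def onePointNoise (θ : LazyGDParams A) (f : Euc m → ℝ) (w : Euc m)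
    (z : shrink A θ.radius × Metric.sphere (0 : Euc m) 1) : ℝ :=
  onePoint θ f w z - ∫ s, onePoint θ f w (z.1, s) ∂sphereUniform m

variable (θ : LazyGDParams A) {f : Euc m → ℝ} {w : Euc m}

theorem continuous_onePoint (hf : ContinuousOn f A) : Continuous (onePoint θ f w) := by
  have h : Continuous fun z : shrink A θ.radius × Metric.sphere (0 : Euc m) 1 =>
      f (query θ z.1 z.2) :=
    hf.comp_continuous (continuous_subtype_val.comp (continuous_query θ)) fun z => (query θ _ _).2
  exact (h.mul (by fun_prop)).const_mul _

theorem measurable_onePointNoise (hm : 0 < m) (hf : ContinuousOn f A) :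
    Measurable (onePointNoise θ f w) := by
  have := isProbabilityMeasure_sphereUniform hm
  have h := (continuous_onePoint (w := w) θ hf).measurable
  exact h.sub ((h.stronglyMeasurable.integral_prod_right' (ν := sphereUniform m)).measurable.comp
    measurable_fst)

theorem abs_inner_direction_le {D : ℝ} (hD : ∀ x ∈ A, ∀ y ∈ A, ‖x - y‖ ≤ D)
    (hw : w ∈ shrink A θ.radius) (x : shrink A θ.radius) (s : Metric.sphere (0 : Euc m) 1) :
    |inner ℝ (s : Euc m) (w - x)| ≤ D := by
  have hs : ‖(s : Euc m)‖ = 1 := by simp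
  refine (abs_real_inner_le_norm _ _).trans ?_
  rw [hs, one_mul]
  exact hD _ (shrink_subset θ.radius_pos.le hw) _ (shrink_subset θ.radius_pos.le x.2)

theorem abs_onePoint_le {G D : ℝ} (hG : ∀ x ∈ A, |f x| ≤ G) (hD : ∀ x ∈ A, ∀ y ∈ A, ‖x - y‖ ≤ D)
    (hw : w ∈ shrink A θ.radius) (z : shrink A θ.radius × Metric.sphere (0 : Euc m) 1) :
    |onePoint θ f w z| ≤ (m : ℝ) / θ.radius * (G * D) := by
  have hr := θ.radius_pos
  have hc : 0 ≤ (m : ℝ) / θ.radius := by positivity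
  have hq := hG _ (query θ z.1 z.2).2
  rw [onePoint, abs_mul, abs_mul, abs_of_nonneg hc]
  exact mul_le_mul_of_nonneg_left (mul_le_mul hq (abs_inner_direction_le θ hD hw _ _)
    (abs_nonneg _) ((abs_nonneg _).trans hq)) hc

theorem abs_onePointNoise_le (hm : 0 < m) {G D : ℝ} (hG : ∀ x ∈ A, |f x| ≤ G)
    (hD : ∀ x ∈ A, ∀ y ∈ A, ‖x - y‖ ≤ D) (hw : w ∈ shrink A θ.radius)
    (z : shrink A θ.radius × Metric.sphere (0 : Euc m) 1) :
    |onePointNoise θ f w z| ≤ 2 * ((m : ℝ) / θ.radius * (G * D)) := by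
  have := isProbabilityMeasure_sphereUniform hm
  have h1 := abs_onePoint_le θ hG hD hw
  have h2 : |∫ s, onePoint θ f w (z.1, s) ∂sphereUniform m| ≤
      (m : ℝ) / θ.radius * (G * D) := by
    have := norm_integral_le_of_norm_le_const (μ := sphereUniform m)
      (f := fun s => onePoint θ f w (z.1, s)) (ae_of_all _ fun s => h1 (z.1, s))
    simpa using this
  exact (abs_sub _ _).trans (by linarith [h1 z])

theorem integral_onePointNoise (hm : 0 < m) (hf : ContinuousOn f A) (x : shrink A θ.radius) :
    ∫ s, onePointNoise θ f w (x, s) ∂sphereUniform m = 0 := by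
  have := isProbabilityMeasure_sphereUniform hm
  have hc : Continuous fun s => onePoint θ f w (x, s) :=
    (continuous_onePoint θ hf).comp (by fun_prop)
  simp only [onePointNoise]
  rw [integral_sub (integrable_sphereUniform hm hc) (integrable_const _)]
  simp

theorem increment_le_integral_onePoint' (hm : 0 < m) {L : ℝ≥0} (hf : ConcaveOn ℝ A f)
    (hL : LipschitzOnWith L f A) (hw : w ∈ shrink A θ.radius) (x : shrink A θ.radius) :
    f w - f x - 2 * L * θ.radius ≤ ∫ s, onePoint θ f w (x, s) ∂sphereUniform m := by
  have hxw : (x : Euc m) + (w - x) = w := by abel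
  have := increment_le_integral_onePoint hm hf hL θ.radius_pos (x := x) (u := w - x) x.2
    (by rw [hxw]; exact hw)
  rw [hxw] at this
  exact this

end OnePoint

/-! ### The lower bound -/

section LowerBound

variable {m k n : ℕ} {A : Set (Euc m)} {B : Set (Euc k)} {UP UA : Euc m → Euc k → ℝ}
  {L₁ L₂ LBR : ℝ≥0}

theorem sum_range_mul_eq (u : ℕ → ℝ) (N M : ℕ) :
    ∑ t ∈ Finset.range (N * M), u t =
      ∑ φ ∈ Finset.range N, ∑ s ∈ Finset.range M, u (φ * M + s) := by
  induction N with
  | zero => simp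
  | succ N ih => rw [Nat.succ_mul, Finset.sum_range_add, ih, Finset.sum_range_succ]

/-- If the forecasts are close to the played strategy on average, then the average utility is close
to the utility against a best-responding agent. -/
theorem abs_sum_utility_sub_le (H : GameAssumptions A B UP UA L₁ L₂ LBR) {M : ℕ} {p : ℕ → A}
    {x : A} {b : ℝ} (hp : ∑ s ∈ Finset.range M, ‖(p s : Euc m) - x‖ ≤ M * b) :
    |∑ s ∈ Finset.range M, UP x (BR B UA (p s)) - M * UP x (BR B UA x)| ≤
      M * (L₂ * (LBR * b)) := by
  have e : ∑ s ∈ Finset.range M, UP x (BR B UA (p s)) - M * UP x (BR B UA x) =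
      ∑ s ∈ Finset.range M, (UP x (BR B UA (p s)) - UP x (BR B UA x)) := by
    simp [Finset.sum_sub_distrib]
  rw [e]
  calc _ ≤ ∑ s ∈ Finset.range M, |UP x (BR B UA (p s)) - UP x (BR B UA x)| :=
        Finset.abs_sum_le_sum_abs _ _
    _ ≤ ∑ s ∈ Finset.range M, L₂ * (LBR * ‖(p s : Euc m) - x‖) :=
        Finset.sum_le_sum fun s _ =>
          (abs_UP_sub_le_snd H x.2 (BR_mem H (p s).2) (BR_mem H x.2)).trans
            (mul_le_mul_of_nonneg_left (norm_BR_sub_le H (p s).2 x.2) L₂.coe_nonneg)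
    _ = L₂ * (LBR * ∑ s ∈ Finset.range M, ‖(p s : Euc m) - x‖) := by
        rw [Finset.mul_sum, Finset.mul_sum]
    _ ≤ L₂ * (LBR * (M * b)) := by gcongr
    _ = _ := by ring

/-- The same estimate for the utility of the averaged action. -/
theorem abs_UP_average_sub_le (H : GameAssumptions A B UP UA L₁ L₂ LBR) {M : ℕ} (hM : 0 < M)
    {p : ℕ → A} {x : A} {b : ℝ} (hp : ∑ s ∈ Finset.range M, ‖(p s : Euc m) - x‖ ≤ M * b) :
    |UP x ((M : ℝ)⁻¹ • ∑ s ∈ Finset.range M, BR B UA (p s)) - UP x (BR B UA x)| ≤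
      L₂ * (LBR * b) := by
  have hM' : (0 : ℝ) < M := by exact_mod_cast hM
  refine (abs_UP_sub_le_snd H x.2 (average_mem H.convex_actions hM fun s _ => BR_mem H (p s).2)
    (BR_mem H x.2)).trans (mul_le_mul_of_nonneg_left ?_ L₂.coe_nonneg)
  have e : (M : ℝ)⁻¹ • ∑ s ∈ Finset.range M, BR B UA (p s) - BR B UA x =
      (M : ℝ)⁻¹ • ∑ s ∈ Finset.range M, (BR B UA (p s) - BR B UA x) := by
    rw [Finset.sum_sub_distrib, smul_sub, Finset.sum_const, Finset.card_range,
      ← Nat.cast_smul_eq_nsmul ℝ, smul_smul, inv_mul_cancel₀ hM'.ne', one_smul]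
  rw [e, norm_smul, norm_inv, Real.norm_of_nonneg hM'.le, inv_mul_le_iff₀ hM']
  calc _ ≤ ∑ s ∈ Finset.range M, ‖BR B UA (p s) - BR B UA x‖ := norm_sum_le _ _
    _ ≤ ∑ s ∈ Finset.range M, LBR * ‖(p s : Euc m) - x‖ :=
        Finset.sum_le_sum fun s _ => norm_BR_sub_le H (p s).2 x.2
    _ = LBR * ∑ s ∈ Finset.range M, ‖(p s : Euc m) - x‖ := by rw [Finset.mul_sum]
    _ ≤ LBR * (M * b) := by gcongr
    _ = _ := by ring

/-- On the event that the forecasts are calibrated on every epoch and the noise of the one-point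
estimates averages out, lazy gradient descent has small regret. -/
theorem sum_utility_lazyGD_ge (H : GameAssumptions A B UP UA L₁ L₂ LBR) (hm : 0 < m)
    (hA : Convex ℝ A) (hA' : IsClosed A) (θ : LazyGDParams A) {γ : ℝ} (hγ : ∀ φ, θ.step φ = γ)
    (init : shrink A θ.radius) {M N : ℕ} (hM : 2 ≤ M) (S : ℕ → Metric.sphere (0 : Euc m) 1)
    (fc : Rule A) {D G b c : ℝ} (hD : ∀ x ∈ A, ∀ y ∈ A, ‖x - y‖ ≤ D)
    (hG : ∀ x ∈ A, |UP x (BR B UA x)| ≤ G) {w : Euc m} (hw : w ∈ shrink A θ.radius)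
    (hcal : ∀ φ < N, ∑ s ∈ Finset.range M,
      ‖((forecast (lazyGD UP UA B θ init M S) fc (φ * M + s) : A) : Euc m) -
        query θ (lazyGDPath UP UA B θ init M S fc φ) (S φ)‖ ≤ M * b)
    (hnoise : |∑ φ ∈ Finset.range N, onePointNoise θ (fun x => UP x (BR B UA x)) w
      (lazyGDPath UP UA B θ init M S fc φ, S φ)| ≤ c * N) :
    M * (N * (UP w (BR B UA w) - 3 * (L₁ + L₂ * LBR) * θ.radius -
        (1 + (m : ℝ) / θ.radius * D) * (L₂ * (LBR * b)) - c) -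
      (D ^ 2 / (2 * γ) + γ / 2 * ((m : ℝ) / θ.radius * (G + L₂ * (LBR * D))) ^ 2 * N)) ≤
    ∑ t ∈ Finset.range (N * M), UP (outcome (lazyGD UP UA B θ init M S) fc t : A)
      (BR B UA (forecast (lazyGD UP UA B θ init M S) fc t : A)) := by
  set adv := lazyGD UP UA B θ init M S with hadv
  set X := lazyGDPath UP UA B θ init M S fc with hX
  set f : Euc m → ℝ := fun x => UP x (BR B UA x) with hf
  set L : ℝ≥0 := L₁ + L₂ * LBR with hL
  have hLip : LipschitzOnWith L f A := lipschitzOn_UP_BR H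
  have hM0 : 0 < M := by omega
  have hr := θ.radius_pos
  have hmr : 0 ≤ (m : ℝ) / θ.radius := by positivity
  let hφ : ℕ → A := fun φ => query θ (X φ) (S φ)
  let ybar : ℕ → Euc k := fun φ =>
    (M : ℝ)⁻¹ • ∑ s ∈ Finset.range M, BR B UA (forecast adv fc (φ * M + s) : A)
  have hD0 : 0 ≤ D := (norm_nonneg _).trans (hD _ (hφ 0).2 _ (hφ 0).2)
  -- the regret of the projected gradient steps
  let v : ℕ → Euc m := fun φ => ((m : ℝ) / θ.radius * UP (hφ φ) (ybar φ)) • (S φ : Euc m)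
  have hreg : ∑ φ ∈ Finset.range N, inner ℝ (v φ) (w - X φ) ≤ D ^ 2 / (2 * γ) +
      γ / 2 * ((m : ℝ) / θ.radius * (G + L₂ * (LBR * D))) ^ 2 * N := by
    refine regret_projected_ascent (x := fun φ => (X φ : Euc m)) (v := v) (w := w)
      (by rw [← hγ 0]; exact θ.step_pos 0) (fun φ => ?_) (fun φ => ?_)
      (hD _ (shrink_subset hr.le (X 0).2) _ (shrink_subset hr.le hw)) N
    · have : Nonempty (shrink A θ.radius) := ⟨init⟩
      have hstep : (X (φ + 1) : Euc m) =
          nearest (shrink A θ.radius) ((X φ : Euc m) + γ • v φ) := by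
        rw [← hγ φ]
        simp only [v, smul_smul]
        rfl
      rw [hstep]
      exact norm_nearest_sub_mem_le (isClosed_shrink hA' _) (convex_shrink hA _) _ hw
    · have hs : ‖(S φ : Euc m)‖ = 1 := by simp
      rw [norm_smul, hs, mul_one, Real.norm_eq_abs, abs_mul, abs_of_nonneg hmr]
      refine mul_le_mul_of_nonneg_left ?_ hmr
      -- The gradient bound is required in every epoch, while calibration is available only for `φ <
      -- N`; the diameter serves as a crude forecast error.
      have h1 : |UP (hφ φ) (ybar φ) - f (hφ φ)| ≤ L₂ * (LBR * D) :=
        abs_UP_average_sub_le H hM0 <| (Finset.sum_le_sum fun s _ =>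
          hD _ (forecast adv fc (φ * M + s)).2 _ (hφ φ).2).trans (le_of_eq (by simp))
      have h2 := abs_sub_abs_le_abs_sub (UP (hφ φ) (ybar φ)) (f (hφ φ))
      have h3 : |f (hφ φ)| ≤ G := hG _ (hφ φ).2
      linarith
  -- the bias of the gradient estimates
  have hest : ∀ φ < N, onePoint θ f w (X φ, S φ) ≤
      inner ℝ (v φ) (w - X φ) + (m : ℝ) / θ.radius * D * (L₂ * (LBR * b)) := by
    intro φ hlt
    have h1 : |UP (hφ φ) (ybar φ) - f (hφ φ)| ≤ L₂ * (LBR * b) :=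
      abs_UP_average_sub_le H hM0 (hcal φ hlt)
    have h2 := abs_inner_direction_le θ hD hw (X φ) (S φ)
    have h3 : |(UP (hφ φ) (ybar φ) - f (hφ φ)) * inner ℝ (S φ : Euc m) (w - X φ)| ≤
        L₂ * (LBR * b) * D := by
      rw [abs_mul]
      exact mul_le_mul h1 h2 (abs_nonneg _) ((abs_nonneg _).trans h1)
    have h4 := mul_le_mul_of_nonneg_left (abs_le.1 h3).1 hmr
    have e1 : onePoint θ f w (X φ, S φ) =
      (m : ℝ) / θ.radius * (f (hφ φ) * inner ℝ (S φ : Euc m) (w - X φ)) := rfl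
    have e2 : inner ℝ (v φ) (w - X φ) =
        (m : ℝ) / θ.radius * UP (hφ φ) (ybar φ) * inner ℝ (S φ : Euc m) (w - X φ) := by
      simp only [v, real_inner_smul_left]
    rw [e1, e2]
    linarith
  have hcenter : ∀ φ, f w - f (X φ) - 2 * L * θ.radius ≤
      onePoint θ f w (X φ, S φ) - onePointNoise θ f w (X φ, S φ) := fun φ => by
    have := increment_le_integral_onePoint' θ hm H.concave_BR hLip hw (X φ)
    rw [onePointNoise]
    linarith
  have hsumX : N * (f w - 2 * L * θ.radius - (m : ℝ) / θ.radius * D * (L₂ * (LBR * b)) - c) -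
      (D ^ 2 / (2 * γ) + γ / 2 * ((m : ℝ) / θ.radius * (G + L₂ * (LBR * D))) ^ 2 * N) ≤
      ∑ φ ∈ Finset.range N, f (X φ) := by
    have h1 : ∑ φ ∈ Finset.range N, (f w - f (X φ) - 2 * L * θ.radius) ≤
        ∑ φ ∈ Finset.range N, (inner ℝ (v φ) (w - X φ) +
          (m : ℝ) / θ.radius * D * (L₂ * (LBR * b)) - onePointNoise θ f w (X φ, S φ)) :=
      Finset.sum_le_sum fun φ hφ' =>
        (hcenter φ).trans (by linarith [hest φ (Finset.mem_range.1 hφ')])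
    simp only [Finset.sum_sub_distrib, Finset.sum_add_distrib, Finset.sum_const,
      Finset.card_range, nsmul_eq_mul] at h1
    have h2 := (abs_le.1 hnoise).1
    linarith
  -- Playing the query instead of the center costs one more `Lδ`, beside the `2Lδ` of the gradient
  -- estimate; this makes the factor `3`.
  have hepoch : ∀ φ < N, M * (f (X φ) - L * θ.radius - L₂ * (LBR * b)) ≤
      ∑ s ∈ Finset.range M, UP (outcome adv fc (φ * M + s) : A)
        (BR B UA (forecast adv fc (φ * M + s) : A)) := by
    intro φ hlt
    have h1 := (abs_le.1 (abs_sum_utility_sub_le H (hcal φ hlt))).1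
    have h2 : |f (hφ φ) - f (X φ)| ≤ L * θ.radius := by
      have hs : ‖(S φ : Euc m)‖ = 1 := by simp
      have := hLip.dist_le_mul _ (hφ φ).2 _ (shrink_subset hr.le (X φ).2)
      simpa [Real.dist_eq, dist_eq_norm, hφ, query, norm_smul, hs, abs_of_pos hr] using this
    have h3 : ∀ s ∈ Finset.range M, UP (outcome adv fc (φ * M + s) : A)
        (BR B UA (forecast adv fc (φ * M + s) : A)) =
        UP (hφ φ) (BR B UA (forecast adv fc (φ * M + s) : A)) := by
      intro s hs
      have hdiv : (φ * M + s) / M = φ := by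
        rw [mul_comm, Nat.mul_add_div hM0, Nat.div_eq_of_lt (Finset.mem_range.1 hs), add_zero]
      rw [hadv, outcome_lazyGD, hdiv]
    rw [Finset.sum_congr rfl h3]
    have h4 : f (X φ) - L * θ.radius ≤ f (hφ φ) := by linarith [(abs_le.1 h2).1]
    have h5 := mul_le_mul_of_nonneg_left h4 (Nat.cast_nonneg (α := ℝ) M)
    have h6 : -(M * (L₂ * (LBR * b))) ≤
      ∑ s ∈ Finset.range M, UP (hφ φ) (BR B UA (forecast adv fc (φ * M + s) : A)) -
        M * f (hφ φ) := h1
    linarith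
  rw [sum_range_mul_eq]
  refine le_trans ?_ (Finset.sum_le_sum fun φ hφ' => hepoch φ (Finset.mem_range.1 hφ'))
  rw [← Finset.mul_sum]
  refine mul_le_mul_of_nonneg_left ?_ (Nat.cast_nonneg _)
  simp only [Finset.sum_sub_distrib, Finset.sum_const, Finset.card_range, nsmul_eq_mul]
  have hLc : (L : ℝ) = L₁ + L₂ * LBR := by rw [hL]; push_cast; ring
  rw [hLc] at hsumX ⊢
  linarith

end LowerBound

/-! ### Convergence in probability of the lower bound -/

section LowerBoundLimit

variable {m k n : ℕ} {A : Set (Euc m)} {B : Set (Euc k)} {UP UA : Euc m → Euc k → ℝ}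
  {L₁ L₂ LBR : ℝ≥0}

/-- Calibrated forecasts follow lazy gradient descent within an epoch. -/
theorem sum_norm_forecast_sub_query_le (g : Grid A n) (θ : LazyGDParams A)
    (init : shrink A θ.radius) {M N φ : ℕ} (hM : 2 ≤ M) (hφ : φ < N)
    (S : ℕ → Metric.sphere (0 : Euc m) 1) (fc : Rule A) {q : ℕ → ℝ}
    (hcal : ∀ s t, s < t → t < N * M → ∀ i, calErr g.tentBinning
      (outcome (lazyGD UP UA B θ init M S) fc) (forecast (lazyGD UP UA B θ init M S) fc) s t i ≤
        q (t - s)) :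
    ∑ s ∈ Finset.range M,
      ‖((forecast (lazyGD UP UA B θ init M S) fc (φ * M + s) : A) : Euc m) -
        query θ (lazyGDPath UP UA B θ init M S fc φ) (S φ)‖ ≤
      M * (4 * g.mesh + Real.sqrt m * n * |q (M - 1)|) := by
  have hle : φ * M + M ≤ N * M := by
    rw [← Nat.succ_mul]
    exact Nat.mul_le_mul_right M hφ
  have hsub : φ * M + M - 1 - φ * M = M - 1 := by omega
  have h := sum_norm_forecast_sub_le (p := forecast (lazyGD UP UA B θ init M S) fc)
    (h := outcome (lazyGD UP UA B θ init M S) fc) g (s := φ * M) (t := φ * M + M - 1)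
    (by omega) (abs_nonneg (q (M - 1)))
    (fun i => (hcal (φ * M) (φ * M + M - 1) (by omega) (by omega) i).trans
      (by rw [hsub]; exact le_abs_self _))
    (x := query θ (lazyGDPath UP UA B θ init M S fc φ) (S φ)) (fun τ hτ => by
      rw [Finset.mem_Icc] at hτ
      have hdiv : τ / M = φ := Nat.div_eq_of_lt_le hτ.1 (by rw [Nat.succ_mul]; omega)
      rw [outcome_lazyGD, hdiv])
  have hIcc : Finset.Icc (φ * M) (φ * M + M - 1) = Finset.Ico (φ * M) (φ * M + M) := by
    ext τ
    simp only [Finset.mem_Icc, Finset.mem_Ico]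
    omega
  rw [hIcc, Finset.sum_Ico_eq_sum_range, Nat.add_sub_cancel_left, Nat.cast_sub (by omega)] at h
  refine h.trans (le_of_eq ?_)
  push_cast
  ring

variable {Ω Ω' : Type*} [MeasurableSpace Ω] [MeasurableSpace Ω']

/-- The noise of the one-point estimates averages out with high probability. -/
theorem measure_noise_le (H : GameAssumptions A B UP UA L₁ L₂ LBR) (hm : 0 < m)
    (hA : Convex ℝ A) (hA' : IsClosed A) (θ : LazyGDParams A) (init : shrink A θ.radius)
    {M N : ℕ} (hM : 0 < M) (hN : 0 < N) {D G c : ℝ} (hD : ∀ x ∈ A, ∀ y ∈ A, ‖x - y‖ ≤ D)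
    (hG : ∀ x ∈ A, |UP x (BR B UA x)| ≤ G) {w : Euc m} (hw : w ∈ shrink A θ.radius) (hc : 0 < c)
    (μ : Measure Ω) [IsProbabilityMeasure μ] (σ : Policy A Ω) (ν : Measure Ω')
    [IsProbabilityMeasure ν] {S : ℕ → Ω' → Metric.sphere (0 : Euc m) 1}
    (hS : ∀ φ, Measurable (S φ)) (hind : iIndepFun S ν)
    (hmap : ∀ φ, ν.map (S φ) = sphereUniform m) :
    (μ.prod ν) {z | c * N < |∑ φ ∈ Finset.range N, onePointNoise θ (fun x => UP x (BR B UA x)) w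
      (lazyGDPath UP UA B θ init M (fun φ => S φ z.2) (σ.rule z.1) φ, S φ z.2)|} ≤
      ENNReal.ofReal ((2 * ((m : ℝ) / θ.radius * (G * D))) ^ 2 / c ^ 2 / N) := by
  have := isProbabilityMeasure_sphereUniform hm
  have : Nonempty (Metric.sphere (0 : Euc m) 1) := nonempty_of_isProbabilityMeasure (sphereUniform m)
  have hf := (lipschitzOn_UP_BR H).continuousOn
  have hF := measurable_onePointNoise (w := w) θ hm hf
  have hmeas : MeasurableSet {z : Ω × Ω' | c * N < |∑ φ ∈ Finset.range N,
      onePointNoise θ (fun x => UP x (BR B UA x)) w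
      (lazyGDPath UP UA B θ init M (fun φ => S φ z.2) (σ.rule z.1) φ, S φ z.2)|} := by
    refine measurableSet_lt measurable_const ?_
    have : Measurable fun z : Ω × Ω' => ∑ φ ∈ Finset.range N,
        onePointNoise θ (fun x => UP x (BR B UA x)) w
        (lazyGDPath UP UA B θ init M (fun φ => S φ z.2) (σ.rule z.1) φ, S φ z.2) :=
      Finset.measurable_fun_sum _ fun φ _ => hF.comp
        ((measurable_lazyGDPath H hA hA' θ init hM hS σ φ).prodMk ((hS φ).comp measurable_snd))
    exact this.abs
  -- With the agent's seed fixed, the centers are functions of earlier directions alone and the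
  -- martingale bound holds on each slice.
  rw [Measure.prod_apply hmeas]
  refine (lintegral_mono fun ω => ?_).trans (le_of_eq (lintegral_const _)) |>.trans
    (le_of_eq (by rw [measure_univ, mul_one]))
  have hG' : ∀ φ, Measurable fun a : ℕ → Metric.sphere (0 : Euc m) 1 =>
      lazyGDPath UP UA B θ init M a (σ.rule ω) φ := fun φ =>
    (measurable_lazyGDPath H hA hA' θ init hM
      (S := fun φ (a : ℕ → Metric.sphere (0 : Euc m) 1) => a φ)
      (fun φ => measurable_pi_apply φ) σ φ).comp measurable_prodMk_left
  exact measure_le_abs_sum_increments (κ := sphereUniform m) hS hind hmap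
    (G := fun φ a => lazyGDPath UP UA B θ init M a (σ.rule ω) φ) hG'
    (fun φ a a' h => lazyGDPath_congr θ init M (σ.rule ω) h) hF
    (abs_onePointNoise_le θ hm hG hD hw) (integral_onePointNoise θ hm hf) hN hc

/-- The step size balances the two terms, leaving a regret per epoch of order `1/√N`. Taking `N + 1`
under the root keeps the step positive at `N = 0`. -/
theorem regret_bound_le {D G γ : ℝ} {N : ℕ} (hN : 0 < N) (hγ : γ = 1 / Real.sqrt ((N : ℝ) + 1)) :
    D ^ 2 / (2 * γ) + γ / 2 * G ^ 2 * N ≤ N * ((D ^ 2 + G ^ 2) * γ) := by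
  have hN' : (1 : ℝ) ≤ N := by exact_mod_cast hN
  have hs : 0 < Real.sqrt ((N : ℝ) + 1) := Real.sqrt_pos.2 (by linarith)
  have hγ0 : 0 < γ := by rw [hγ]; positivity
  have hγN : 1 = γ ^ 2 * (N + 1) := by
    rw [hγ, div_pow, Real.sq_sqrt (by linarith)]
    field_simp
  have h1 : D ^ 2 / (2 * γ) = D ^ 2 * γ * (N + 1) / 2 := by
    rw [div_eq_iff (by positivity)]
    calc D ^ 2 = D ^ 2 * 1 := (mul_one _).symm
      _ = D ^ 2 * (γ ^ 2 * (N + 1)) := by rw [← hγN]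
      _ = _ := by ring
  have h2 : D ^ 2 * γ * (N + 1) ≤ D ^ 2 * γ * (2 * N) := by gcongr; linarith
  have h3 : 0 ≤ γ * G ^ 2 * N := by positivity
  rw [h1]
  linarith

/-- Points of the inner parallel set that are nearly optimal. -/
theorem exists_mem_shrink_stackelbergValue_le (H : GameAssumptions A B UP UA L₁ L₂ LBR)
    (hA : Convex ℝ A) (hA' : IsCompact A) {D : ℝ} (hD : ∀ x ∈ A, ∀ y ∈ A, ‖x - y‖ ≤ D)
    {c : Euc m} {ρ t : ℝ} (hρ : 0 ≤ ρ) (hc : Metric.closedBall c ρ ⊆ A) (ht : 0 < t)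
    (ht1 : t ≤ 1) :
    ∃ w ∈ shrink A (t * ρ),
      stackelbergValue A B UP UA - (L₁ + L₂ * LBR) * (t * D) ≤ UP w (BR B UA w) := by
  have hcA : c ∈ A := hc (Metric.mem_closedBall_self hρ)
  obtain ⟨x, hx, hV, -⟩ := exists_stackelberg_strategy H hA' ⟨c, hcA⟩
  have hw := convexCombination_mem_shrink hA hc hx ht ht1
  refine ⟨_, hw, ?_⟩
  have hlip := (lipschitzOn_UP_BR H).dist_le_mul _
    (shrink_subset (by positivity) hw) x hx
  have hdist : dist ((1 - t) • x + t • c) x ≤ t * D := by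
    rw [dist_eq_norm, show (1 - t) • x + t • c - x = t • (c - x) by module, norm_smul,
      Real.norm_of_nonneg ht.le]
    exact mul_le_mul_of_nonneg_left (hD _ hcA _ hx) ht.le
  have h1 := hlip.trans (mul_le_mul_of_nonneg_left hdist (NNReal.coe_nonneg _))
  rw [Real.dist_eq] at h1
  push_cast at h1
  rw [hV]
  linarith [(abs_le.1 h1).1]

/-- Outside two events, miscalibration and large noise, `sum_utility_lazyGD_ge` applies. The errors
that survive the limit are those in `hsmall`: the comparator, the radius and the mesh. -/
theorem tendsto_measure_lt_stackelbergValue (hm : 0 < m) (hA : Convex ℝ A) (hA' : IsCompact A)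
    (g : Grid A n) {D : ℝ} (hD : ∀ x ∈ A, ∀ y ∈ A, ‖x - y‖ ≤ D) {c₀ : Euc m} {ρ t : ℝ}
    (hρ : 0 < ρ) (hc₀ : Metric.closedBall c₀ ρ ⊆ A) (ht : 0 < t) (ht1 : t ≤ 1) {ε₀ : ℝ}
    (hsmall : (L₁ + L₂ * LBR) * (t * D) + 3 * (L₁ + L₂ * LBR) * (t * ρ) +
      (1 + (m : ℝ) / (t * ρ) * D) * (L₂ * (LBR * (4 * g.mesh))) < ε₀)
    (θ : ℕ → LazyGDParams A) (hθ : ∀ N, (θ N).radius = t * ρ)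
    (hstep : ∀ N φ, (θ N).step φ = 1 / Real.sqrt ((N : ℝ) + 1))
    (H : GameAssumptions A B UP UA L₁ L₂ LBR) (μ : Measure Ω) [IsProbabilityMeasure μ]
    (σ : ℕ → Policy A Ω) (r : ℝ → ℕ → ℕ → ℝ)
    (hσ : ∀ T, AdaptivelyCalibrated μ (σ T) T 0 g.tentBinning (fun δ => r δ T))
    (ν : Measure Ω') [IsProbabilityMeasure ν] {S : ℕ → Ω' → Metric.sphere (0 : Euc m) 1}
    (hS : ∀ φ, Measurable (S φ)) (hind : iIndepFun S ν)
    (hmap : ∀ φ, ν.map (S φ) = sphereUniform m)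
    (init : ∀ N, shrink A (θ N).radius) (Φ M : ℕ → ℕ) (hΦ : Tendsto Φ atTop atTop)
    (hM : Tendsto M atTop atTop)
    (hr : ∀ δ ∈ Ioo (0 : ℝ) 1, Tendsto (fun j => r δ (Φ j * M j) (M j - 1)) atTop (𝓝 0)) :
    Tendsto (fun j => (μ.prod ν) {z | avgUtility UP UA B
        (lazyGD UP UA B (θ (Φ j)) (init (Φ j)) (M j) (fun φ => S φ z.2))
        ((σ (Φ j * M j)).rule z.1) (Φ j * M j) < stackelbergValue A B UP UA - ε₀})
      atTop (𝓝 0) := by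
  obtain ⟨w, hw, hwV⟩ := exists_mem_shrink_stackelbergValue_le H hA hA' hD hρ.le hc₀ ht ht1
  obtain ⟨G, hG⟩ := hA'.exists_bound_of_continuousOn (lipschitzOn_UP_BR H).continuousOn
  simp only [Real.norm_eq_abs] at hG
  have htρ : 0 < t * ρ := by positivity
  set V := stackelbergValue A B UP UA with hVdef
  set L : ℝ := L₁ + L₂ * LBR with hL
  set R := t * ρ with hR
  set Q : ℝ := 1 + (m : ℝ) / R * D with hQ
  set e₀ : ℝ := L * (t * D) + 3 * L * R + Q * (L₂ * (LBR * (4 * g.mesh))) with he₀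
  -- Half of the strict slack in `hsmall` is reserved for the average noise.
  obtain ⟨c, hc, hce⟩ : ∃ c : ℝ, 0 < c ∧ e₀ + c < ε₀ :=
    ⟨(ε₀ - e₀) / 2, by linarith, by linarith⟩
  set G' : ℝ := (m : ℝ) / R * (G + L₂ * (LBR * D)) with hG'
  have hinv : Tendsto (fun j => 1 / Real.sqrt ((Φ j : ℝ) + 1)) atTop (𝓝 0) := by
    have h1 : Tendsto (fun j => ((Φ j : ℝ) + 1)) atTop atTop :=
      tendsto_atTop_add_const_right _ _ (tendsto_natCast_atTop_atTop.comp hΦ)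
    have h2 := (Real.tendsto_sqrt_atTop.comp h1).inv_tendsto_atTop
    simp only [one_div]
    exact h2
  refine tendsto_zero_of_eventually_le_ofReal fun δ hδ => ?_
  have hδ2 : δ / 2 ∈ Ioo (0 : ℝ) 1 := ⟨by linarith [hδ.1], by linarith [hδ.2, hδ.1]⟩
  -- The confidence is split evenly between calibration and noise. The rate has no prescribed sign,
  -- hence the absolute value.
  set q : ℕ → ℝ := fun j => |r (δ / 2) (Φ j * M j) (M j - 1)| with hq
  have hlim : Tendsto (fun j => (L * (t * D) + 3 * L * R +
      Q * (L₂ * (LBR * (4 * g.mesh + Real.sqrt m * n * q j))) + c) +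
      (D ^ 2 + G' ^ 2) * (1 / Real.sqrt ((Φ j : ℝ) + 1))) atTop (𝓝 ((L * (t * D) + 3 * L * R +
      Q * (L₂ * (LBR * (4 * g.mesh + Real.sqrt m * n * |0|))) + c) + (D ^ 2 + G' ^ 2) * 0)) :=
    (((((((hr _ hδ2).abs.const_mul _).const_add _).const_mul _).const_mul _).const_mul
      _).const_add _ |>.add_const _).add (hinv.const_mul _)
  rw [abs_zero, mul_zero, mul_zero, add_zero, add_zero] at hlim
  -- The radius does not change with the number of epochs, so the Chebyshev bound vanishes as it
  -- grows.
  have hcheb : Tendsto (fun j => (2 * ((m : ℝ) / R * (G * D))) ^ 2 / c ^ 2 / (Φ j : ℝ)) atTop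
      (𝓝 0) :=
    (tendsto_natCast_atTop_atTop.comp hΦ).const_div_atTop _
  filter_upwards [hlim.eventually_lt_const hce, hcheb.eventually_lt_const hδ2.1,
    hΦ.eventually_ge_atTop 1, hM.eventually_ge_atTop 2] with j hj hjc hΦj hMj
  have hM0 : 0 < M j := by omega
  have hwθ : w ∈ shrink A (θ (Φ j)).radius := by rw [hθ]; exact hw
  let adv := lazyGDPolicy H hA hA'.isClosed (θ (Φ j)) (init (Φ j)) hM0 S hS
  have hmis := measure_miscalibrated_le (ν := ν) (fun i => measurable_tentBinning g i)
    (hσ (Φ j * M j)) adv hδ2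
  have hnoise := measure_noise_le H hm hA hA'.isClosed (θ (Φ j)) (init (Φ j)) hM0 hΦj hD hG hwθ hc
    μ (σ (Φ j * M j)) ν hS hind hmap
  have htotal : ENNReal.ofReal δ = ENNReal.ofReal (δ / 2) + ENNReal.ofReal (δ / 2) := by
    rw [← ENNReal.ofReal_add hδ2.1.le hδ2.1.le, add_halves]
  rw [htotal]
  refine le_trans (measure_mono ?_) ((measure_union_le _ _).trans
    (add_le_add hmis (hnoise.trans (ENNReal.ofReal_le_ofReal (by rw [hθ]; exact hjc.le)))))
  intro z hz
  by_contra hgood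
  rw [mem_union, not_or, miscalibrated, notMem_compl_iff] at hgood
  obtain ⟨hcal, hnz⟩ := hgood
  have hsum := sum_utility_lazyGD_ge H hm hA hA'.isClosed (θ (Φ j)) (hstep (Φ j)) (init (Φ j)) hMj
    (fun φ => S φ z.2) ((σ (Φ j * M j)).rule z.1) hD hG hwθ
    (fun φ hφ => sum_norm_forecast_sub_query_le (UP := UP) (UA := UA) (B := B) g (θ (Φ j))
      (init (Φ j)) hMj hφ (fun φ => S φ z.2) ((σ (Φ j * M j)).rule z.1) hcal)
    (not_lt.1 hnz)
  simp only [hθ] at hsum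
  have hreg := regret_bound_le (D := D) (G := G') hΦj rfl
  have hMpos : (0 : ℝ) < M j := by exact_mod_cast hM0
  have hΦpos : (0 : ℝ) < Φ j := by exact_mod_cast hΦj
  have hz' : avgUtility UP UA B
        (lazyGD UP UA B (θ (Φ j)) (init (Φ j)) (M j) (fun φ => S φ z.2))
        ((σ (Φ j * M j)).rule z.1) (Φ j * M j) < V - ε₀ := hz
  rw [avgUtility, div_lt_iff₀ (by push_cast; positivity)] at hz'
  have h1 := hsum.trans_lt hz'
  push_cast at h1
  rw [show (V - ε₀) * ((Φ j : ℝ) * M j) = M j * (Φ j * (V - ε₀)) by ring] at h1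
  have h2 := lt_of_mul_lt_mul_left h1 hMpos.le
  have h3 : (Φ j : ℝ) * (UP w (BR B UA w) - 3 * L * R -
      Q * (L₂ * (LBR * (4 * g.mesh + Real.sqrt m * n * q j))) - c -
      (D ^ 2 + G' ^ 2) * (1 / Real.sqrt ((Φ j : ℝ) + 1))) < Φ j * (V - ε₀) := by
    refine lt_of_le_of_lt ?_ h2
    rw [mul_sub _ _ ((D ^ 2 + G' ^ 2) * _)]
    exact sub_le_sub_left hreg _
  have h4 := lt_of_mul_lt_mul_left h3 hΦpos.le
  linarith

end LowerBoundLimit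
end CSG

end

/-! ### Choice of the radius and of the mesh -/

theorem mainTheorem4 {m : ℕ} (A : Set (CSG.Euc m)) (hA_ne : A.Nonempty) (hA_conv : Convex ℝ A)
    (hA_cpt : IsCompact A) (L₁ L₂ LBR : ℝ≥0) (ε₀ : ℝ) (hε₀ : 0 < ε₀) :
    ∃ (n : ℕ) (g : CSG.Grid A n),
      -- lazy gradient descent without a gradient achieves at least `V* - ε₀`
      (0 < m → (interior A).Nonempty →
        ∃ θ : ℕ → CSG.LazyGDParams A,
          ∀ (k : ℕ) (B : Set (CSG.Euc k)) (UP UA : CSG.Euc m → CSG.Euc k → ℝ),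
            CSG.GameAssumptions A B UP UA L₁ L₂ LBR →
          ∀ (Ω : Type*) [MeasurableSpace Ω] (μ : Measure Ω) [IsProbabilityMeasure μ]
            (σ : ℕ → CSG.Policy A Ω) (r : ℝ → ℕ → ℕ → ℝ),
            (∀ T, CSG.AdaptivelyCalibrated μ (σ T) T 0 g.tentBinning (fun δ => r δ T)) →
          ∀ (Ω' : Type*) [MeasurableSpace Ω'] (ν : Measure Ω') [IsProbabilityMeasure ν]
            (S : ℕ → Ω' → Metric.sphere (0 : CSG.Euc m) 1),
            (∀ φ, Measurable (S φ)) → iIndepFun S ν →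
            (∀ φ, ν.map (S φ) = CSG.sphereUniform m) →
          ∀ (init : ∀ Φ, CSG.shrink A (θ Φ).radius) (Φ M : ℕ → ℕ),
            Tendsto Φ atTop atTop → Tendsto M atTop atTop →
            (∀ δ ∈ Ioo (0 : ℝ) 1,
              Tendsto (fun j => r δ (Φ j * M j) (M j - 1)) atTop (𝓝 0)) →
            Tendsto (fun j => (μ.prod ν) {z | CSG.avgUtility UP UA B
                (CSG.lazyGD UP UA B (θ (Φ j)) (init (Φ j)) (M j) (fun φ => S φ z.2))
                ((σ (Φ j * M j)).rule z.1) (Φ j * M j)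
                < CSG.stackelbergValue A B UP UA - ε₀}) atTop (𝓝 0)) ∧
      -- no principal strategy achieves more than `V* + ε₀`
      (∀ (k : ℕ) (B : Set (CSG.Euc k)) (UP UA : CSG.Euc m → CSG.Euc k → ℝ),
          CSG.GameAssumptions A B UP UA L₁ L₂ LBR →
        ∀ (Ω : Type*) [MeasurableSpace Ω] (μ : Measure Ω) [IsProbabilityMeasure μ]
          (σ : ℕ → CSG.Policy A Ω) (r : ℝ → ℕ → ℕ → ℝ),
          (∀ T, CSG.AdaptivelyCalibrated μ (σ T) T 0 g.tentBinning (fun δ => r δ T)) →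
          (∀ δ ∈ Ioo (0 : ℝ) 1, Tendsto (fun T => r δ T (T - 1)) atTop (𝓝 0)) →
        ∀ (Ω' : Type*) [MeasurableSpace Ω'] (ν : Measure Ω') [IsProbabilityMeasure ν]
          (adv : ℕ → CSG.Policy A Ω'),
          Tendsto (fun T => (μ.prod ν) {z | CSG.stackelbergValue A B UP UA + ε₀ <
              CSG.avgUtility UP UA B ((adv T).rule z.2) ((σ T).rule z.1) T}) atTop (𝓝 0)) := by
  have hm_cases : (0 < m ∧ (interior A).Nonempty) ∨ ¬ (0 < m ∧ (interior A).Nonempty) := em _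
  rcases hm_cases with ⟨hm, c₀, hint⟩ | hdeg
  · obtain ⟨ρ, hρ, hball⟩ := Metric.nhds_basis_closedBall.mem_iff.1 (mem_interior_iff_mem_nhds.1 hint)
    have hD : ∀ x ∈ A, ∀ y ∈ A, ‖x - y‖ ≤ Metric.diam A := fun x hx y hy => by
      rw [← dist_eq_norm]
      exact Metric.dist_le_diam_of_mem hA_cpt.isBounded hx hy
    have hD0 : 0 ≤ Metric.diam A := Metric.diam_nonneg
    set D := Metric.diam A
    set L : ℝ := L₁ + L₂ * LBR with hL
    have hL0 : 0 ≤ L := by positivity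
    -- The radius will be `tρ`; this `t` makes the comparator and radius errors at most `ε₀/4`
    -- together. The `+ 1` keeps the divisor positive when `L = 0`.
    obtain ⟨t, ht, ht1, htL⟩ : ∃ t : ℝ, 0 < t ∧ t ≤ 1 ∧ t * (L * (D + 3 * ρ) + 1) ≤ ε₀ / 4 := by
      have hpos : 0 < L * (D + 3 * ρ) + 1 := by positivity
      refine ⟨min 1 (ε₀ / 4 / (L * (D + 3 * ρ) + 1)), by positivity, min_le_left _ _, ?_⟩
      rw [← le_div_iff₀ hpos]
      exact min_le_right _ _
    have htρ : 0 < t * ρ := by positivity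
    -- `Q` dominates the coefficient of the mesh in either bound, so mesh `ε₀/(2Q)` costs at most
    -- `ε₀/2` in each. It depends on `t`, so the mesh comes second.
    set Q : ℝ := (1 + (m : ℝ) / (t * ρ) * D) * (L₂ * (LBR * 4)) + 2 * L + 1 with hQ
    have hQ1 : 0 ≤ (1 + (m : ℝ) / (t * ρ) * D) * (L₂ * (LBR * 4)) := by positivity
    have hQ0 : 0 < Q := by positivity
    obtain ⟨n, g, hg⟩ := CSG.exists_grid hA_cpt (show 0 < ε₀ / (2 * Q) by positivity)
    have hgQ : g.mesh * Q = ε₀ / 2 := by rw [hg]; field_simp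
    have hg0 := g.mesh_pos
    have hx₀ := CSG.convexCombination_mem_shrink hA_conv hball
      (hball (Metric.mem_closedBall_self hρ.le)) ht ht1
    refine ⟨n, g, fun _ _ => ?_, ?_⟩
    · refine ⟨fun N => ⟨t * ρ, htρ, ⟨_, hx₀⟩, fun _ => 1 / Real.sqrt ((N : ℝ) + 1),
        fun _ => by positivity⟩, ?_⟩
      intro k B UP UA H Ω _ μ _ σ r hσ Ω' _ ν _ S hS hind hmap init Φ M hΦ hM hr
      refine CSG.tendsto_measure_lt_stackelbergValue hm hA_conv hA_cpt g hD hρ hball ht ht1 ?_ _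
        (fun _ => rfl) (fun _ _ => rfl) H μ σ r hσ ν hS hind hmap init Φ M hΦ hM hr
      have h1 : 0 ≤ g.mesh * (2 * L + 1) := by positivity
      rw [hQ, mul_add, mul_add] at hgQ
      nlinarith
    · intro k B UP UA H Ω _ μ _ σ r hσ hr Ω' _ ν _ adv
      refine CSG.tendsto_measure_gt_stackelbergValue hA_conv hA_cpt g ?_ H μ σ r hσ hr ν adv
      have h1 := mul_nonneg hg0.le hQ1
      rw [hQ, mul_add, mul_add] at hgQ
      nlinarith
  -- Without interior, or in dimension zero, the first claim is vacuous and the mesh need only serve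
  -- the upper bound.
  · set L : ℝ := L₁ + L₂ * LBR with hL
    have hL0 : 0 ≤ L := by positivity
    obtain ⟨n, g, hg⟩ := CSG.exists_grid hA_cpt (show 0 < ε₀ / (2 * L + 1) by positivity)
    have hgL : g.mesh * (2 * L + 1) = ε₀ := by rw [hg]; field_simp
    have hg0 := g.mesh_pos
    refine ⟨n, g, fun hm hint => absurd ⟨hm, hint⟩ hdeg, ?_⟩
    intro k B UP UA H Ω _ μ _ σ r hσ hr Ω' _ ν _ adv
    refine CSG.tendsto_measure_gt_stackelbergValue hA_conv hA_cpt g ?_ H μ σ r hσ hr ν adv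
    linarith
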